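/- Let $\{(X_i,Y_i)\}_{i\ge 1}$ be a stochastic process over a finite alphabet $\mathcal X\times\mathcal Y$, let $\rho>0$, let $\log$ denote $\log_2$, and put $\tilde\rho=1/(1+\rho)$. For a pair $(X,Y)$ with joint PMF $P$ on a finite set, let $$H_{\tilde\rho}(X|Y)=\frac{\tilde\rho}{1-\tilde\rho}\log\sum_{y}\Bigl(\sum_{x}P(x,y)^{\tilde\rho}\Bigr)^{1/\tilde\rho},$$ and suppose that the limit $H=\lim_{n\to\infty}H_{\tilde\rho}(X^n|Y^n)/n$ exists, where $(X^n,Y^n)$ consists of the first $n$ pairs. Fix integers $0\le\eta<\nu\le\delta$ and a per-hint storage rate $R_s\ge 0$. At blocklength $n$, a stochastic encoder observes $(X^n,Y^n)$ and draws hints $M=(M_1,\dots,M_\delta)$, each of $s=\lfloor nR_s\rfloor$ bits (so each takes values in a set of size $2^s$), according to a conditional PMF given $(X^n,Y^n)$. A guessing function on $\mathcal X^n$ is a bijection $G:\mathcal X^n\to\{1,\dots,|\mathcal X|^n\}$. For a set $S$ of disks write $M_S=(M_i)_{i\in S}$. Below, $\mathcal B$ ranges over the subsets of $\{1,\dots,\delta\}$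 of size $\nu$, $\mathcal E$ ranges over those of size $\eta$, and $G_{\mathcal B}(\cdot|y,m_{\mathcal B})$, $G_{\mathcal E}(\cdot|y,m_{\mathcal E})$ are guessing functions for every value of the conditioning variables. Bob's ambiguity is, in the guessing version and in the list version respectively, $$\mathscr A_B^{(g)}=\min_{(G_{\mathcal B})}\mathbb E\Bigl[\max_{\mathcal B}G_{\mathcal B}(X^n|Y^n,M_{\mathcal B})^\rho\Bigr],\qquad \mathscr A_B^{(l)}=\mathbb E\Bigl[\max_{\mathcal B}\bigl|\mathcal L^{Y^n}_{M_{\mathcal B}}\bigr|^\rho\Bigr],$$ where $\mathcal L^{y}_{m_{\mathcal B}}$ is the set of all $x\in\mathcal X^n$ with $\Pr[X^n=x\mid Y^n=y,M_{\mathcal B}=m_{\mathcal B}]>0$. Eve's ambiguity, in both versions, is $$\mathscr A_E=\min_{(G_{\mathcal E})}\mathbb E\Bigl[\min_{\mathcal E}G_{\mathcal E}(X^n|Y^n,M_{\mathcal E})^\rho\Bigr].$$ For either version, the privacy-exponent $\overline{E_E}$ is the supremum of all real $E$ for which there is a sequence of encoders (one for each $n$) with $\lim_{n}\mathscr A_B=1$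 and $\liminf_{n}\frac1n\log\mathscr A_E\ge E$. For $E_B\ge 0$, the modest privacy-exponent $\overline{E_E^m(E_B)}$ is the supremum of all real $E$ for which there is a sequence of encoders with $\limsup_n\frac1n\log\mathscr A_B\le E_B$ and $\liminf_n\frac1n\log\mathscr A_E\ge E$. The supremum of the empty set is $-\infty$. Then, in both the guessing version and the list version, $$\overline{E_E}=\begin{cases}\rho\,\min\{R_s(\nu-\eta),\,H\} & \text{if }\nu R_s>H,\\ -\infty & \text{if }\nu R_s<H,\end{cases}$$ and, for every $E_B\ge 0$, $$\overline{E_E^m(E_B)}=\begin{cases}\min\{\rho R_s(\nu-\eta)+E_B,\ \rho H\} & \text{if }\nu R_s\ge H-\rho^{-1}E_B,\\ -\infty & \text{if }\nu R_s<H-\rho^{-1}E_B,\end{cases}$$ where, in the list version, the first case of the formula for $\overline{E_E^m(E_B)}$ is asserted only for $R_s>0$. -/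

import Mathlib

namespace DiskFailure

noncomputable section

/-- The conditional Rényi entropy of order `α` (Arimoto), in bits, of a joint mass function
`P x y`, for `α ∈ (0, 1) ∪ (1, ∞)`:
`α / (1 - α) * log₂ ∑ y, (∑ x, P x y ^ α) ^ (1 / α)`. -/
def condRenyiEntropy {A B : Type*} [Fintype A] [Fintype B] (α : ℝ) (P : A → B → ℝ) : ℝ :=
  α / (1 - α) * Real.logb 2 (∑ y, (∑ x, P x y ^ α) ^ (1 / α))

/-- The joint mass function of `(X^n, Y^n)`, where `X^n` and `Y^n` are the first `n` entries. -/
def blockPMF {Ω A B : Type*} [MeasurableSpace Ω] (μ : MeasureTheory.Measure Ω)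
    (X : ℕ → Ω → A) (Y : ℕ → Ω → B) (n : ℕ) (x : Fin n → A) (y : Fin n → B) : ℝ :=
  μ.real {ω | (∀ i : Fin n, X i ω = x i) ∧ (∀ i : Fin n, Y i ω = y i)}

/-- A hint of `s` bits: a set of `2 ^ s` elements (only its cardinality matters). -/
abbrev Hint (s : ℕ) : Type := Fin s → Bool

/-- A stochastic encoder: for every `(x, y)` a conditional distribution of the `δ` hints. -/
abbrev Encoder (A B : Type*) (δ s : ℕ) := A → B → PMF (Fin δ → Hint s)

/-- The sets of `k` disks. -/
abbrev Disks (δ k : ℕ) : Type := {S : Finset (Fin δ) // S.card = k}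

/-- A guessing function: `G x` is the position, counted from `0`, at which `x` is guessed. -/
abbrev GuessingFn (A : Type*) [Fintype A] := A ≃ Fin (Fintype.card A)

/-- The number of guesses that are made until `x` is guessed, an element of `{1, …, |A|}`. -/
def GuessingFn.numGuesses {A : Type*} [Fintype A] (G : GuessingFn A) (x : A) : ℕ := (G x : ℕ) + 1

/-- For every set `S` of `k` disks, a guessing function for `X` given `Y` and the hints in `S`. -/
abbrev GuessingStrategy (A B : Type*) [Fintype A] (δ s k : ℕ) :=
  (S : Disks δ k) → B → (S.1 → Hint s) → GuessingFn A

section OneShot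

variable {A B : Type*} [Fintype A] [Fintype B] {δ s : ℕ}

/-- The expectation of `f (X, Y, M)` for `(X, Y) ∼ P` and `M` drawn by the encoder. -/
def expect (P : A → B → ℝ) (W : Encoder A B δ s) (f : A → B → (Fin δ → Hint s) → ℝ) : ℝ :=
  ∑ x, ∑ y, ∑ m, P x y * (W x y m).toReal * f x y m

/-- The conditional probability that the hints in `S` equal `m`, given `(X, Y) = (x, y)`. -/
def hintProb (W : Encoder A B δ s) (S : Finset (Fin δ)) (m : S → Hint s) (x : A) (y : B) : ℝ :=
  ∑ m' : Fin δ → Hint s with S.restrict m' = m, (W x y m').toReal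

/-- The posterior probability of `X = x` given `Y = y` and that the hints in `S` equal `m`. -/
def posterior (P : A → B → ℝ) (W : Encoder A B δ s) (S : Finset (Fin δ)) (m : S → Hint s)
    (x : A) (y : B) : ℝ :=
  P x y * hintProb W S m x y / ∑ x', P x' y * hintProb W S m x' y

/-- The list of all realizations of `X` of positive posterior probability. -/
def decodingList (P : A → B → ℝ) (W : Encoder A B δ s) (S : Finset (Fin δ)) (y : B)
    (m : S → Hint s) : Finset A :=
  {x : A | 0 < posterior P W S m x y}

/-- Bob's ambiguity in the guessing version; he sees a worst-case set of `ν` hints. -/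
def bobGuessAmbiguity (ρ : ℝ) (ν : ℕ) (P : A → B → ℝ) (W : Encoder A B δ s) : ℝ :=
  ⨅ G : GuessingStrategy A B δ s ν, expect P W fun x y m =>
    ⨆ S : Disks δ ν, ((G S y (S.1.restrict m)).numGuesses x : ℝ) ^ ρ

/-- Bob's ambiguity in the list version; he sees a worst-case set of `ν` hints. -/
def bobListAmbiguity (ρ : ℝ) (ν : ℕ) (P : A → B → ℝ) (W : Encoder A B δ s) : ℝ :=
  expect P W fun _ y m =>
    ⨆ S : Disks δ ν, ((decodingList P W S.1 y (S.1.restrict m)).card : ℝ) ^ ρ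

/-- Eve's ambiguity; she sees a set of `η` hints that is the best one for her. -/
def eveAmbiguity (ρ : ℝ) (η : ℕ) (P : A → B → ℝ) (W : Encoder A B δ s) : ℝ :=
  ⨅ G : GuessingStrategy A B δ s η, expect P W fun x y m =>
    ⨅ S : Disks δ η, ((G S y (S.1.restrict m)).numGuesses x : ℝ) ^ ρ

end OneShot

/-- The two versions of the problem, which differ in the definition of Bob's ambiguity. -/
inductive Version
  | guessing
  | list

/-- Bob's ambiguity in either version of the problem. -/
def bobAmbiguity {A B : Type*} [Fintype A] [Fintype B] {δ s : ℕ} :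
    Version → ℝ → ℕ → (A → B → ℝ) → Encoder A B δ s → ℝ
  | .guessing => bobGuessAmbiguity
  | .list => bobListAmbiguity

section Asymptotic

variable {A B : Type*} [Fintype A] [Fintype B]

/-- The number of bits per hint, at blocklength `n` and per-hint storage rate `R`. -/
abbrev hintBits (R : ℝ) (n : ℕ) : ℕ := ⌊(n : ℝ) * R⌋₊

/-- A sequence of stochastic encoders, one for each blocklength. -/
abbrev EncoderSeq (A B : Type*) (δ : ℕ) (R : ℝ) :=
  (n : ℕ) → Encoder (Fin n → A) (Fin n → B) δ (hintBits R n)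

/-- `E` is an achievable ambiguity-exponent; `P n` is the mass function of `(X^n, Y^n)`. -/
def IsAchievable (v : Version) (ρ : ℝ) (δ ν η : ℕ) (R : ℝ)
    (P : (n : ℕ) → (Fin n → A) → (Fin n → B) → ℝ) (E : ℝ) : Prop :=
  ∃ W : EncoderSeq A B δ R,
    Filter.Tendsto (fun n => bobAmbiguity v ρ ν (P n) (W n)) Filter.atTop (nhds 1) ∧
    (E : EReal) ≤ Filter.liminf
      (fun n : ℕ => ((Real.logb 2 (eveAmbiguity ρ η (P n) (W n)) / n : ℝ) : EReal)) Filter.atTop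

/-- `E` is an achievable modest-ambiguity-exponent for the exponent `EB` granted to Bob. -/
def IsModestAchievable (v : Version) (ρ : ℝ) (δ ν η : ℕ) (R : ℝ)
    (P : (n : ℕ) → (Fin n → A) → (Fin n → B) → ℝ) (EB E : ℝ) : Prop :=
  ∃ W : EncoderSeq A B δ R,
    Filter.limsup (fun n : ℕ => ((Real.logb 2 (bobAmbiguity v ρ ν (P n) (W n)) / n : ℝ) : EReal))
      Filter.atTop ≤ (EB : EReal) ∧
    (E : EReal) ≤ Filter.liminf
      (fun n : ℕ => ((Real.logb 2 (eveAmbiguity ρ η (P n) (W n)) / n : ℝ) : EReal)) Filter.atTop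

/-- The privacy-exponent: the supremum of all achievable ambiguity-exponents, which is
`⊥ = -∞` if there are none. -/
def privacyExponent (v : Version) (ρ : ℝ) (δ ν η : ℕ) (R : ℝ)
    (P : (n : ℕ) → (Fin n → A) → (Fin n → B) → ℝ) : EReal :=
  ⨆ E : {E : ℝ // IsAchievable v ρ δ ν η R P E}, ((E : ℝ) : EReal)

/-- The modest privacy-exponent: the supremum of all achievable modest-ambiguity-exponents,
which is `⊥ = -∞` if there are none. -/
def modestPrivacyExponent (v : Version) (ρ : ℝ) (δ ν η : ℕ) (R : ℝ)
    (P : (n : ℕ) → (Fin n → A) → (Fin n → B) → ℝ) (EB : ℝ) : EReal :=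
  ⨆ E : {E : ℝ // IsModestAchievable v ρ δ ν η R P EB E}, ((E : ℝ) : EReal)

end Asymptotic

end

end DiskFailure

/-!
By Arikan's inequalities, the least `ρ`-th moment of the number of guesses of `X` given `Y` is
`renyiSum ρ P = 2 ^ (ρ * H)`, up to a factor that is polynomial in the blocklength.

Converse. Someone who lacks some of Bob's hints can interleave the guessing orders that Bob would
use for all values of the missing hints, at the price of a factor that is the number of these
values. For Eve, who lacks `ν - η` of the hints, this bounds `E` by `ρ * Rs * (ν - η) + EB`; for
someone without any hints it bounds `ρ * H` by `ρ * Rs * ν + EB`.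

Direct part. Label `x` by the logarithmic scale of its position in the best guessing order and by
the residue of this position modulo `K`, so that only about `1 + G x / K` symbols share the label
of `x`. Store the label by a Reed–Solomon code of length `δ` and dimension `ν`, part of whose first
`η` coefficients are drawn at random: any `ν` hints determine the label, and any `η` hints are
determined by no less than the label and all of the randomness. As the reciprocal positions of a
guessing order sum to at most `1 + log |A|`, summing over the values of the hints and over the
disk sets of Eve leaves her, by a reverse Hölder inequality, with an ambiguity that grows with the
rate `α` of the randomness. The theorem follows by taking `α` as large as Bob's constraint permits.
-/

namespace DiskFailure

open Finset Filter Topology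

section Guessing

variable {A : Type*} [Fintype A]

instance : Nonempty (GuessingFn A) := ⟨Fintype.equivFin A⟩

lemma GuessingFn.one_le_numGuesses (G : GuessingFn A) (x : A) : 1 ≤ G.numGuesses x :=
  Nat.succ_pos _

lemma GuessingFn.numGuesses_le_card (G : GuessingFn A) (x : A) :
    G.numGuesses x ≤ Fintype.card A :=
  (G x).2

lemma GuessingFn.numGuesses_injective (G : GuessingFn A) : Function.Injective G.numGuesses :=
  (add_left_injective 1).comp (Fin.val_injective.comp G.injective)

lemma GuessingFn.card_numGuesses_le (G : GuessingFn A) (t : ℕ) :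
    #{x | G.numGuesses x ≤ t} ≤ t := by
  have h : #{x | G.numGuesses x ≤ t} ≤ #(Icc 1 t) :=
    card_le_card_of_injOn G.numGuesses
      (fun x hx => mem_coe.2 (mem_Icc.2 ⟨G.one_le_numGuesses x, (mem_filter.1 hx).2⟩))
      G.numGuesses_injective.injOn
  simpa using h

lemma GuessingFn.sum_inv_numGuesses_le (G : GuessingFn A) :
    ∑ x, (G.numGuesses x : ℝ)⁻¹ ≤ 1 + Real.log (Fintype.card A) := by
  have h : ∑ x, (G.numGuesses x : ℝ)⁻¹ = (harmonic (Fintype.card A) : ℝ) := by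
    rw [harmonic, Rat.cast_sum, ← Fin.sum_univ_eq_sum_range
      (fun i => (((↑(i + 1) : ℚ)⁻¹ : ℚ) : ℝ)), ← Equiv.sum_comp G]
    simp [GuessingFn.numGuesses]
  exact h ▸ harmonic_le_one_add_log _

lemma exists_guessingFn_le_card {α : Type*} [LinearOrder α] (c : A → α) :
    ∃ G : GuessingFn A, ∀ x, G.numGuesses x ≤ #{x' | c x' ≤ c x} := by
  classical
  let e := Fintype.equivFin A
  let σ := Tuple.sort (c ∘ e.symm)
  have hmono : Monotone (c ∘ e.symm ∘ σ) := Tuple.monotone_sort (c ∘ e.symm)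
  refine ⟨e.trans σ.symm, fun x => ?_⟩
  set i := σ.symm (e x) with hi
  have hx : e.symm (σ i) = x := by simp [hi]
  calc (i : ℕ) + 1 = #((Iic i).image (e.symm ∘ σ)) := by
        rw [card_image_of_injective _ (e.symm.injective.comp σ.injective), Fin.card_Iic]
    _ ≤ #{x' | c x' ≤ c x} := card_le_card <| image_subset_iff.2 fun j hj => by
        simpa [hx] using hmono (mem_Iic.1 hj)

/-- Symbols are guessed in the order of their first occurrence in any of the given orders. -/
lemma GuessingFn.exists_interleave {ι : Type*} [Fintype ι] (G : ι → GuessingFn A) :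
    ∃ F : GuessingFn A, ∀ i x,
      F.numGuesses x ≤ Fintype.card ι * (G i).numGuesses x := by
  classical
  let c (x : A) : ℕ := ⨅ i, (G i).numGuesses x
  obtain ⟨F, hF⟩ := exists_guessingFn_le_card c
  refine ⟨F, fun i x => ?_⟩
  have hne : Nonempty ι := ⟨i⟩
  calc F.numGuesses x ≤ #{x' | c x' ≤ c x} := hF x
    _ ≤ #(univ.biUnion fun j => {x' | (G j).numGuesses x' ≤ c x}) := by
        refine card_le_card fun x' hx' => ?_
        obtain ⟨j, hj⟩ := exists_eq_ciInf_of_finite (f := fun j => (G j).numGuesses x')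
        exact mem_biUnion.2 ⟨j, mem_univ j, by simpa [hj] using hx'⟩
    _ ≤ #(univ : Finset ι) * c x :=
        card_biUnion_le_card_mul _ _ _ fun j _ => (G j).card_numGuesses_le (c x)
    _ ≤ Fintype.card ι * (G i).numGuesses x := by
        rw [card_univ]
        gcongr
        exact Finite.ciInf_le _ i

/-- Guessing in decreasing order of `q`. -/
lemma exists_guessingFn_mul_le_sum {q : A → ℝ} (hq : ∀ x, 0 ≤ q x) :
    ∃ G : GuessingFn A, ∀ x, G.numGuesses x * q x ≤ ∑ x', q x' := by
  obtain ⟨G, hG⟩ := exists_guessingFn_le_card fun x => -q x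
  refine ⟨G, fun x => ?_⟩
  calc G.numGuesses x * q x ≤ (#{x' | -q x' ≤ -q x} : ℝ) * q x := by
        gcongr
        exacts [hq x, hG x]
    _ ≤ ∑ x' with -q x' ≤ -q x, q x' := by
        rw [← nsmul_eq_mul]
        exact card_nsmul_le_sum _ _ _ fun x' hx' => neg_le_neg_iff.1 (mem_filter.1 hx').2
    _ ≤ ∑ x', q x' := sum_le_univ_sum_of_nonneg hq

lemma exists_guessingFn_sum_mul_rpow_le {ρ : ℝ} (hρ : 0 ≤ ρ) {p : A → ℝ}
    (hp : ∀ x, 0 ≤ p x) :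
    ∃ G : GuessingFn A, ∑ x, p x * (G.numGuesses x : ℝ) ^ ρ ≤
      (∑ x, p x ^ (1 / (1 + ρ))) ^ (1 + ρ) := by
  have hρ1 : 1 + ρ ≠ 0 := by positivity
  have hq (x : A) : 0 ≤ p x ^ (1 / (1 + ρ)) := Real.rpow_nonneg (hp x) _
  have hT : 0 ≤ ∑ x, p x ^ (1 / (1 + ρ)) := sum_nonneg fun x _ => hq x
  obtain ⟨G, hG⟩ := exists_guessingFn_mul_le_sum hq
  refine ⟨G, ?_⟩
  rw [Real.rpow_add' hT hρ1, Real.rpow_one, sum_mul]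
  refine sum_le_sum fun x _ => ?_
  have hpq : p x = p x ^ (1 / (1 + ρ)) * (p x ^ (1 / (1 + ρ))) ^ ρ := by
    rw [← Real.rpow_one_add' (hq x) hρ1, one_div, Real.rpow_inv_rpow (hp x) hρ1]
  calc p x * (G.numGuesses x : ℝ) ^ ρ
      = p x ^ (1 / (1 + ρ)) * (G.numGuesses x * p x ^ (1 / (1 + ρ))) ^ ρ := by
        rw [Real.mul_rpow (Nat.cast_nonneg _) (hq x), mul_left_comm, ← hpq, mul_comm]
    _ ≤ p x ^ (1 / (1 + ρ)) * (∑ x, p x ^ (1 / (1 + ρ))) ^ ρ := by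
        have hGx : (0 : ℝ) ≤ G.numGuesses x := Nat.cast_nonneg _
        gcongr
        exacts [hq x, mul_nonneg hGx (hq x), hG x]

end Guessing

lemma rpow_sum_rpow_le_mul_sum_mul_rpow {ι : Type*} (s : Finset ι) {ρ : ℝ} (hρ : 0 ≤ ρ)
    {p g : ι → ℝ} (hp : ∀ i, 0 ≤ p i) (hg : ∀ i, 0 < g i) :
    (∑ i ∈ s, p i ^ (1 / (1 + ρ))) ^ (1 + ρ) ≤
      (∑ i ∈ s, (g i)⁻¹) ^ ρ * ∑ i ∈ s, p i * g i ^ ρ := by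
  have hρ1 : 1 + ρ ≠ 0 := by positivity
  have hinv : 0 ≤ ∑ i ∈ s, (g i)⁻¹ := sum_nonneg fun i _ => (inv_pos.2 (hg i)).le
  have hsum : 0 ≤ ∑ i ∈ s, p i * g i ^ ρ :=
    sum_nonneg fun i _ => mul_nonneg (hp i) (Real.rpow_nonneg (hg i).le _)
  have hq (i : ι) : 0 ≤ p i ^ (1 / (1 + ρ)) := Real.rpow_nonneg (hp i) _
  have hterm (i : ι) : (g i)⁻¹ * (g i * p i ^ (1 / (1 + ρ))) ^ (1 + ρ) = p i * g i ^ ρ := by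
    rw [Real.mul_rpow (hg i).le (hq i), one_div, Real.rpow_inv_rpow (hp i) hρ1,
      Real.rpow_add (hg i), Real.rpow_one, mul_assoc, inv_mul_cancel_left₀ (hg i).ne', mul_comm]
  have hölder := Real.inner_le_weight_mul_Lp_of_nonneg s (p := 1 + ρ) (by linarith)
    (fun i => (g i)⁻¹) (fun i => g i * p i ^ (1 / (1 + ρ))) (fun i => (inv_pos.2 (hg i)).le)
    fun i => mul_nonneg (hg i).le (hq i)
  simp only [hterm, inv_mul_cancel_left₀ (hg _).ne'] at hölder
  calc (∑ i ∈ s, p i ^ (1 / (1 + ρ))) ^ (1 + ρ)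
      ≤ ((∑ i ∈ s, (g i)⁻¹) ^ (1 - (1 + ρ)⁻¹) *
          (∑ i ∈ s, p i * g i ^ ρ) ^ (1 + ρ)⁻¹) ^ (1 + ρ) :=
        Real.rpow_le_rpow (sum_nonneg fun i _ => hq i) hölder (by positivity)
    _ = (∑ i ∈ s, (g i)⁻¹) ^ ρ * ∑ i ∈ s, p i * g i ^ ρ := by
        have hexp : (1 - (1 + ρ)⁻¹) * (1 + ρ) = ρ := by field_simp; ring
        rw [Real.mul_rpow (by positivity) (by positivity), ← Real.rpow_mul hinv, hexp,
          Real.rpow_inv_rpow hsum hρ1]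

lemma one_add_log_card_pos (A : Type*) [Fintype A] : 0 < 1 + Real.log (Fintype.card A) :=
  add_pos_of_pos_of_nonneg one_pos (Real.log_natCast_nonneg _)

section Renyi

variable {A B : Type*} [Fintype A] [Fintype B] {ρ : ℝ} {P : A → B → ℝ}

/-- The number `2 ^ (ρ * H)`, where `H` is the conditional Rényi entropy of order `1 / (1 + ρ)`. -/
noncomputable def renyiSum (ρ : ℝ) (P : A → B → ℝ) : ℝ :=
  ∑ y, (∑ x, P x y ^ (1 / (1 + ρ))) ^ (1 + ρ)

lemma logb_renyiSum (hρ : 0 < ρ) (P : A → B → ℝ) :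
    Real.logb 2 (renyiSum ρ P) = ρ * condRenyiEntropy (1 / (1 + ρ)) P := by
  have h : 1 / (1 + ρ) / (1 - 1 / (1 + ρ)) = ρ⁻¹ := by
    rw [one_sub_div (by positivity), add_sub_cancel_left]
    field_simp
  rw [condRenyiEntropy, h, renyiSum, one_div_one_div, mul_inv_cancel_left₀ hρ.ne']

lemma renyiSum_le_mul_sum_mul_rpow_numGuesses (hρ : 0 ≤ ρ) (hP : ∀ x y, 0 ≤ P x y)
    (G : B → GuessingFn A) :
    renyiSum ρ P ≤ (1 + Real.log (Fintype.card A)) ^ ρ *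
      ∑ x, ∑ y, P x y * ((G y).numGuesses x : ℝ) ^ ρ := by
  rw [sum_comm, mul_sum]
  refine sum_le_sum fun y _ => (rpow_sum_rpow_le_mul_sum_mul_rpow univ hρ (fun x => hP x y)
    fun x => Nat.cast_pos.2 ((G y).one_le_numGuesses x)).trans ?_
  gcongr
  · exact sum_nonneg fun x _ => mul_nonneg (hP x y) (by positivity)
  · exact (G y).sum_inv_numGuesses_le

lemma exists_guessingFn_sum_le_renyiSum (hρ : 0 ≤ ρ) (hP : ∀ x y, 0 ≤ P x y) :
    ∃ G : B → GuessingFn A,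
      ∑ x, ∑ y, P x y * ((G y).numGuesses x : ℝ) ^ ρ ≤ renyiSum ρ P := by
  choose G hG using fun y => exists_guessingFn_sum_mul_rpow_le hρ fun x => hP x y
  exact ⟨G, sum_comm.trans_le (sum_le_sum fun y _ => hG y)⟩

end Renyi

section Ambiguity

variable {A B : Type*} [Fintype A] [Fintype B] {δ s : ℕ} {ρ : ℝ} {P : A → B → ℝ}

/-- The function `P` is the mass function of a pair of random variables. -/
structure IsJointPMF (P : A → B → ℝ) : Prop where
  nonneg : ∀ x y, 0 ≤ P x y
  sum_eq_one : ∑ x, ∑ y, P x y = 1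

lemma sum_toReal_apply {α : Type*} [Fintype α] (p : PMF α) : ∑ a, (p a).toReal = 1 := by
  rw [← ENNReal.toReal_sum fun a _ => p.apply_ne_top a, ← tsum_fintype (L := .unconditional _),
    p.tsum_coe, ENNReal.toReal_one]

lemma expect_mono (hP : ∀ x y, 0 ≤ P x y) (W : Encoder A B δ s)
    {f g : A → B → (Fin δ → Hint s) → ℝ}
    (h : ∀ x y m, 0 < P x y → W x y m ≠ 0 → f x y m ≤ g x y m) :
    expect P W f ≤ expect P W g := by
  refine sum_le_sum fun x _ => sum_le_sum fun y _ => sum_le_sum fun m _ => ?_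
  rcases (hP x y).eq_or_lt' with hxy | hxy
  · simp [hxy]
  rcases eq_or_ne (W x y m) 0 with hm | hm
  · simp [hm]
  exact mul_le_mul_of_nonneg_left (h x y m hxy hm) (by positivity)

lemma expect_const_mul (P : A → B → ℝ) (W : Encoder A B δ s) (c : ℝ)
    (f : A → B → (Fin δ → Hint s) → ℝ) :
    expect P W (fun x y m => c * f x y m) = c * expect P W f := by
  simp only [expect, mul_sum, mul_left_comm _ c]

lemma expect_eq_sum (P : A → B → ℝ) (W : Encoder A B δ s) (f : A → B → ℝ) :
    expect P W (fun x y _ => f x y) = ∑ x, ∑ y, P x y * f x y := by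
  simp only [expect, ← sum_mul, ← mul_sum, sum_toReal_apply, mul_one]

lemma IsJointPMF.one_le_expect (hP : IsJointPMF P) (W : Encoder A B δ s)
    {f : A → B → (Fin δ → Hint s) → ℝ} (h : ∀ x y m, 1 ≤ f x y m) : 1 ≤ expect P W f :=
  calc 1 = expect P W fun _ _ _ => 1 := by simp [expect_eq_sum, hP.sum_eq_one]
    _ ≤ expect P W f := expect_mono hP.nonneg W fun x y m _ _ => h x y m

lemma nonempty_disks {k : ℕ} (h : k ≤ δ) : Nonempty (Disks δ k) := by
  obtain ⟨S, -, hS⟩ := exists_subset_card_eq (s := (univ : Finset (Fin δ))) (n := k) (by simpa)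
  exact ⟨⟨S, hS⟩⟩

lemma GuessingFn.one_le_numGuesses_rpow (hρ : 0 ≤ ρ) (G : GuessingFn A) (x : A) :
    1 ≤ (G.numGuesses x : ℝ) ^ ρ :=
  Real.one_le_rpow (Nat.one_le_cast.2 (G.one_le_numGuesses x)) hρ

lemma one_le_eveAmbiguity (hρ : 0 ≤ ρ) {η : ℕ} (hη : η ≤ δ) (hP : IsJointPMF P)
    (W : Encoder A B δ s) : 1 ≤ eveAmbiguity ρ η P W := by
  have := nonempty_disks hη
  exact le_ciInf fun G => hP.one_le_expect W fun x y m =>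
    le_ciInf fun S => GuessingFn.one_le_numGuesses_rpow hρ _ x

lemma one_le_bobGuessAmbiguity (hρ : 0 ≤ ρ) {ν : ℕ} (hν : ν ≤ δ) (hP : IsJointPMF P)
    (W : Encoder A B δ s) : 1 ≤ bobGuessAmbiguity ρ ν P W := by
  obtain ⟨S⟩ := nonempty_disks hν
  exact le_ciInf fun G => hP.one_le_expect W fun x y m =>
    le_ciSup_of_le (Set.finite_range _).bddAbove S (GuessingFn.one_le_numGuesses_rpow hρ _ x)

lemma eveAmbiguity_le_renyiSum (hρ : 0 ≤ ρ) {η : ℕ} (hη : η ≤ δ) (hP : ∀ x y, 0 ≤ P x y)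
    (W : Encoder A B δ s) : eveAmbiguity ρ η P W ≤ renyiSum ρ P := by
  obtain ⟨G, hG⟩ := exists_guessingFn_sum_le_renyiSum hρ hP
  have := nonempty_disks hη
  refine (Finite.ciInf_le _ fun _ y _ => G y).trans (le_of_eq_of_le ?_ hG)
  simp only [ciInf_const]
  exact expect_eq_sum P W _

lemma bobGuessAmbiguity_le_renyiSum (hρ : 0 ≤ ρ) {ν : ℕ} (hν : ν ≤ δ) (hP : ∀ x y, 0 ≤ P x y)
    (W : Encoder A B δ s) : bobGuessAmbiguity ρ ν P W ≤ renyiSum ρ P := by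
  obtain ⟨G, hG⟩ := exists_guessingFn_sum_le_renyiSum hρ hP
  have := nonempty_disks hν
  refine (Finite.ciInf_le _ fun _ y _ => G y).trans (le_of_eq_of_le ?_ hG)
  simp only [ciSup_const]
  exact expect_eq_sum P W _

lemma IsJointPMF.one_le_renyiSum (hP : IsJointPMF P) (hρ : 0 ≤ ρ) : 1 ≤ renyiSum ρ P :=
  let W : Encoder A B 0 0 := fun _ _ => PMF.pure fun _ _ => false
  (one_le_eveAmbiguity hρ le_rfl hP W).trans (eveAmbiguity_le_renyiSum hρ le_rfl hP.nonneg W)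

lemma hintProb_nonneg {A B : Type*} (W : Encoder A B δ s) (S : Finset (Fin δ))
    (m : S → Hint s) (x : A) (y : B) : 0 ≤ hintProb W S m x y :=
  sum_nonneg fun _ _ => ENNReal.toReal_nonneg

lemma hintProb_restrict_pos {A B : Type*} {W : Encoder A B δ s} {m : Fin δ → Hint s} {x : A}
    {y : B} (hm : W x y m ≠ 0) (S : Finset (Fin δ)) : 0 < hintProb W S (S.restrict m) x y :=
  (ENNReal.toReal_pos hm ((W x y).apply_ne_top m)).trans_le <|
    single_le_sum (f := fun m' => (W x y m').toReal) (fun _ _ => ENNReal.toReal_nonneg)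
      (mem_filter.2 ⟨mem_univ m, rfl⟩)

lemma mem_decodingList_restrict {B : Type*} {P : A → B → ℝ} (hP : ∀ x y, 0 ≤ P x y)
    {W : Encoder A B δ s} {m : Fin δ → Hint s} {x : A} {y : B} (hx : 0 < P x y)
    (hm : W x y m ≠ 0) (S : Finset (Fin δ)) : x ∈ decodingList P W S y (S.restrict m) := by
  have hpos : 0 < P x y * hintProb W S (S.restrict m) x y :=
    mul_pos hx (hintProb_restrict_pos hm S)
  exact mem_filter.2 ⟨mem_univ x, div_pos hpos <| hpos.trans_le <| single_le_sum
    (f := fun x' => P x' y * hintProb W S (S.restrict m) x' y)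
    (fun x' _ => mul_nonneg (hP x' y) (hintProb_nonneg W S _ x' y)) (mem_univ x)⟩

lemma exists_restrict_eq_of_mem_decodingList {B : Type*} {P : A → B → ℝ} {W : Encoder A B δ s}
    {S : Finset (Fin δ)} {m : S → Hint s} {x : A} {y : B} (hx : x ∈ decodingList P W S y m) :
    ∃ m', S.restrict m' = m ∧ W x y m' ≠ 0 := by
  by_contra! h
  have h0 : hintProb W S m x y = 0 :=
    sum_eq_zero fun m' hm' => by rw [h m' (mem_filter.1 hm').2, ENNReal.toReal_zero]
  have hpos : 0 < posterior P W S m x y := (mem_filter.1 hx).2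
  simp [posterior, h0] at hpos

lemma bobGuessAmbiguity_le_bobListAmbiguity (hρ : 0 ≤ ρ) (ν : ℕ) (hP : ∀ x y, 0 ≤ P x y)
    (W : Encoder A B δ s) : bobGuessAmbiguity ρ ν P W ≤ bobListAmbiguity ρ ν P W := by
  classical
  choose G hG using fun (S : Disks δ ν) (y : B) (m : S.1 → Hint s) =>
    exists_guessingFn_le_card fun x => x ∉ decodingList P W S.1 y m
  refine (Finite.ciInf_le _ G).trans (expect_mono hP W fun x y m hx hm => ?_)
  refine ciSup_mono (Set.finite_range _).bddAbove fun S => ?_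
  gcongr
  refine (hG S y _ x).trans (card_le_card fun x' hx' => not_not.1 fun hx'' => ?_)
  exact (mem_filter.1 hx').2 hx'' (mem_decodingList_restrict hP hx hm S.1)

lemma bobGuessAmbiguity_le_bobAmbiguity (hρ : 0 ≤ ρ) (ν : ℕ) (hP : ∀ x y, 0 ≤ P x y)
    (v : Version) (W : Encoder A B δ s) :
    bobGuessAmbiguity ρ ν P W ≤ bobAmbiguity v ρ ν P W := by
  cases v
  exacts [le_rfl, bobGuessAmbiguity_le_bobListAmbiguity hρ ν hP W]

lemma bobAmbiguity_le_bobListAmbiguity (hρ : 0 ≤ ρ) (ν : ℕ) (hP : ∀ x y, 0 ≤ P x y)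
    (v : Version) (W : Encoder A B δ s) :
    bobAmbiguity v ρ ν P W ≤ bobListAmbiguity ρ ν P W := by
  cases v
  exacts [bobGuessAmbiguity_le_bobListAmbiguity hρ ν hP W, le_rfl]

lemma one_le_bobAmbiguity (hρ : 0 ≤ ρ) {ν : ℕ} (hν : ν ≤ δ) (hP : IsJointPMF P) (v : Version)
    (W : Encoder A B δ s) : 1 ≤ bobAmbiguity v ρ ν P W :=
  (one_le_bobGuessAmbiguity hρ hν hP W).trans
    (bobGuessAmbiguity_le_bobAmbiguity hρ ν hP.nonneg v W)

end Ambiguity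

section Converse

variable {A B : Type*} [Fintype A] [Fintype B] {δ s : ℕ} {ρ : ℝ} {P : A → B → ℝ}

/-- The hints in `T` that agree with `m` on `S` and with `h` off `S`: what Bob would see if `h`
were the hints that he sees and Eve does not. -/
def joinHints {S T : Finset (Fin δ)} (m : S → Hint s) (h : ↥(T \ S) → Hint s) : T → Hint s :=
  fun i => if hi : (i : Fin δ) ∈ S then m ⟨i, hi⟩ else h ⟨i, mem_sdiff.2 ⟨i.2, hi⟩⟩

lemma joinHints_restrict (S T : Finset (Fin δ)) (m : Fin δ → Hint s) :
    joinHints (S.restrict m) ((T \ S).restrict m) = T.restrict m := by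
  ext i : 1
  simp [joinHints]

lemma card_restricted_hints (S : Finset (Fin δ)) (s : ℕ) :
    Fintype.card (S → Hint s) = (2 ^ s) ^ #S := by
  simp

lemma exists_expect_eq_bobGuessAmbiguity (ρ : ℝ) (ν : ℕ) (P : A → B → ℝ)
    (W : Encoder A B δ s) :
    ∃ G : GuessingStrategy A B δ s ν, expect P W (fun x y m => ⨆ S : Disks δ ν,
      ((G S y (S.1.restrict m)).numGuesses x : ℝ) ^ ρ) = bobGuessAmbiguity ρ ν P W :=
  exists_eq_ciInf_of_finite

lemma GuessingFn.exists_interleave_rpow_le (hρ : 0 ≤ ρ) (S : Finset (Fin δ))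
    (G : (S → Hint s) → GuessingFn A) :
    ∃ F : GuessingFn A, ∀ m x, (F.numGuesses x : ℝ) ^ ρ ≤
      (((2 : ℝ) ^ s) ^ #S) ^ ρ * ((G m).numGuesses x : ℝ) ^ ρ := by
  obtain ⟨F, hF⟩ := GuessingFn.exists_interleave G
  refine ⟨F, fun m x => ?_⟩
  have h : (F.numGuesses x : ℝ) ≤ ((2 : ℝ) ^ s) ^ #S * (G m).numGuesses x := by
    have h := hF m x
    rw [card_restricted_hints] at h
    exact_mod_cast h
  rw [← Real.mul_rpow (by positivity) (by positivity)]
  gcongr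

/-- Eve interleaves the guessing orders of Bob for all values of the hints that she lacks. -/
lemma eveAmbiguity_le_mul_bobGuessAmbiguity (hρ : 0 ≤ ρ) {η ν : ℕ} (hην : η ≤ ν) (hν : ν ≤ δ)
    (hP : ∀ x y, 0 ≤ P x y) (W : Encoder A B δ s) :
    eveAmbiguity ρ η P W ≤ (((2 : ℝ) ^ s) ^ (ν - η)) ^ ρ * bobGuessAmbiguity ρ ν P W := by
  obtain ⟨T⟩ := nonempty_disks hν
  obtain ⟨S, hST, hS⟩ := exists_subset_card_eq (s := T.1) (n := η) (by rwa [T.2])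
  obtain ⟨G, hG⟩ := exists_expect_eq_bobGuessAmbiguity ρ ν P W
  choose F hF using fun (S' : Disks δ η) (y : B) (m : S'.1 → Hint s) =>
    GuessingFn.exists_interleave_rpow_le hρ (T.1 \ S'.1) fun h => G T y (joinHints m h)
  have hcard : #(T.1 \ S) = ν - η := by rw [card_sdiff_of_subset hST, T.2, hS]
  rw [← hG, ← expect_const_mul]
  refine (Finite.ciInf_le _ F).trans (expect_mono hP W fun x y m _ _ => ?_)
  calc _ ≤ ((F ⟨S, hS⟩ y (S.restrict m)).numGuesses x : ℝ) ^ ρ :=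
        Finite.ciInf_le (fun S' : Disks δ η =>
          ((F S' y (S'.1.restrict m)).numGuesses x : ℝ) ^ ρ) ⟨S, hS⟩
    _ ≤ (((2 : ℝ) ^ s) ^ (ν - η)) ^ ρ * ((G T y (T.1.restrict m)).numGuesses x : ℝ) ^ ρ := by
        simpa only [joinHints_restrict, hcard] using
          hF ⟨S, hS⟩ y (S.restrict m) ((T.1 \ S).restrict m) x
    _ ≤ _ := mul_le_mul_of_nonneg_left (Finite.le_ciSup (fun T : Disks δ ν =>
          ((G T y (T.1.restrict m)).numGuesses x : ℝ) ^ ρ) T) (by positivity)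

/-- Without any hints, one interleaves the guessing orders of Bob for all values of his hints. -/
lemma renyiSum_le_mul_bobGuessAmbiguity (hρ : 0 ≤ ρ) {ν : ℕ} (hν : ν ≤ δ)
    (hP : ∀ x y, 0 ≤ P x y) (W : Encoder A B δ s) :
    renyiSum ρ P ≤ ((1 + Real.log (Fintype.card A)) * ((2 : ℝ) ^ s) ^ ν) ^ ρ *
      bobGuessAmbiguity ρ ν P W := by
  obtain ⟨T⟩ := nonempty_disks hν
  obtain ⟨G, hG⟩ := exists_expect_eq_bobGuessAmbiguity ρ ν P W
  choose F hF using fun y => GuessingFn.exists_interleave_rpow_le hρ T.1 (G T y)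
  have hlog := (one_add_log_card_pos A).le
  rw [Real.mul_rpow hlog (by positivity), mul_assoc, ← hG, ← expect_const_mul]
  refine (renyiSum_le_mul_sum_mul_rpow_numGuesses hρ hP F).trans ?_
  rw [← expect_eq_sum P W fun x y => ((F y).numGuesses x : ℝ) ^ ρ]
  refine mul_le_mul_of_nonneg_left (expect_mono hP W fun x y m _ _ => ?_) (by positivity)
  calc ((F y).numGuesses x : ℝ) ^ ρ
      ≤ (((2 : ℝ) ^ s) ^ ν) ^ ρ * ((G T y (T.1.restrict m)).numGuesses x : ℝ) ^ ρ := by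
        simpa only [T.2] using hF y (T.1.restrict m) x
    _ ≤ _ := mul_le_mul_of_nonneg_left (Finite.le_ciSup (fun T : Disks δ ν =>
          ((G T y (T.1.restrict m)).numGuesses x : ℝ) ^ ρ) T) (by positivity)

end Converse

section UniformEncoder

variable {A B R : Type*} [Fintype R] [Nonempty R] {δ s : ℕ}

/-- The encoder that draws `r` uniformly at random and stores the hints `c x y r`. -/
noncomputable def uniformEncoder (c : A → B → R → Fin δ → Hint s) : Encoder A B δ s :=
  fun x y => (PMF.uniformOfFintype R).map (c x y)

lemma exists_eq_of_uniformEncoder_ne_zero {c : A → B → R → Fin δ → Hint s} {x : A} {y : B}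
    {m : Fin δ → Hint s} (h : uniformEncoder c x y m ≠ 0) : ∃ r, c x y r = m := by
  obtain ⟨r, -, hr⟩ := (PMF.mem_support_map_iff _ _ _).1 ((PMF.mem_support_iff _ _).2 h)
  exact ⟨r, hr⟩

lemma sum_uniformEncoder_mul (c : A → B → R → Fin δ → Hint s) (x : A) (y : B)
    (f : (Fin δ → Hint s) → ℝ) :
    ∑ m, (uniformEncoder c x y m).toReal * f m =
      (Fintype.card R : ℝ)⁻¹ * ∑ r, f (c x y r) := by
  classical
  have h (m : Fin δ → Hint s) : (uniformEncoder c x y m).toReal =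
      ∑ r, if m = c x y r then (Fintype.card R : ℝ)⁻¹ else 0 := by
    rw [uniformEncoder, PMF.map_apply, tsum_fintype, ENNReal.toReal_sum]
    · exact sum_congr rfl fun r _ => by split_ifs <;> simp
    · intro r _
      split_ifs <;> simp
  simp only [h, sum_mul, ite_mul, zero_mul]
  rw [sum_comm, mul_sum]
  simp

lemma expect_uniformEncoder [Fintype A] [Fintype B] (P : A → B → ℝ)
    (c : A → B → R → Fin δ → Hint s) (f : A → B → (Fin δ → Hint s) → ℝ) :
    expect P (uniformEncoder c) f =
      ∑ y, ∑ i : A × R, P i.1 y * (Fintype.card R : ℝ)⁻¹ * f i.1 y (c i.1 y i.2) := by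
  rw [expect, sum_comm]
  simp only [mul_assoc, ← mul_sum, sum_uniformEncoder_mul, Fintype.sum_prod_type]

end UniformEncoder

section Eve

variable {A B R : Type*} [Fintype A] [Fintype B] [Fintype R] {δ s : ℕ} {ρ : ℝ} {P : A → B → ℝ}

lemma inv_ciInf_le_sum_inv {ι : Type*} [Fintype ι] [Nonempty ι] {a : ι → ℝ}
    (ha : ∀ i, 0 ≤ a i) : (⨅ i, a i)⁻¹ ≤ ∑ i, (a i)⁻¹ := by
  obtain ⟨i, hi⟩ := exists_eq_ciInf_of_finite (f := a)
  rw [← hi]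
  exact single_le_sum (f := fun i => (a i)⁻¹) (fun j _ => inv_nonneg.2 (ha j)) (mem_univ i)

lemma sum_inv_numGuesses_le_of_injective {M : Type*} [Fintype M] (G : M → GuessingFn A)
    {c : A → R → M} (hc : ∀ x, Function.Injective (c x)) :
    ∑ x, ∑ r, ((G (c x r)).numGuesses x : ℝ)⁻¹ ≤
      Fintype.card M * (1 + Real.log (Fintype.card A)) := by
  classical
  calc ∑ x, ∑ r, ((G (c x r)).numGuesses x : ℝ)⁻¹
      = ∑ x, ∑ m ∈ univ.image (c x), ((G m).numGuesses x : ℝ)⁻¹ :=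
        sum_congr rfl fun x _ => (sum_image (f := fun m => ((G m).numGuesses x : ℝ)⁻¹)
          (hc x).injOn).symm
    _ ≤ ∑ x, ∑ m, ((G m).numGuesses x : ℝ)⁻¹ :=
        sum_le_sum fun x _ => sum_le_univ_sum_of_nonneg fun m => by positivity
    _ = ∑ m, ∑ x, ((G m).numGuesses x : ℝ)⁻¹ := sum_comm
    _ ≤ ∑ _m : M, (1 + Real.log (Fintype.card A)) :=
        sum_le_sum fun m _ => (G m).sum_inv_numGuesses_le
    _ = Fintype.card M * (1 + Real.log (Fintype.card A)) := by
        rw [sum_const, card_univ, nsmul_eq_mul]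

lemma sum_inv_ciInf_numGuesses_le {η : ℕ} (hη : η ≤ δ)
    (G : (S : Disks δ η) → (S.1 → Hint s) → GuessingFn A) {c : A → R → Fin δ → Hint s}
    (hc : ∀ x, ∀ S : Disks δ η, Function.Injective fun r => S.1.restrict (c x r)) :
    ∑ i : A × R, (⨅ S, ((G S (S.1.restrict (c i.1 i.2))).numGuesses i.1 : ℝ))⁻¹ ≤
      δ.choose η * (((2 : ℝ) ^ s) ^ η * (1 + Real.log (Fintype.card A))) := by
  have := nonempty_disks hη
  have hcard (S : Disks δ η) : (Fintype.card (S.1 → Hint s) : ℝ) = ((2 : ℝ) ^ s) ^ η := by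
    rw [card_restricted_hints, S.2]
    push_cast
    rfl
  calc ∑ i : A × R, (⨅ S, ((G S (S.1.restrict (c i.1 i.2))).numGuesses i.1 : ℝ))⁻¹
      ≤ ∑ i : A × R, ∑ S, ((G S (S.1.restrict (c i.1 i.2))).numGuesses i.1 : ℝ)⁻¹ :=
        sum_le_sum fun i _ => inv_ciInf_le_sum_inv fun S => Nat.cast_nonneg _
    _ = ∑ S, ∑ x, ∑ r, ((G S (S.1.restrict (c x r))).numGuesses x : ℝ)⁻¹ := by
        rw [sum_comm]
        simp only [Fintype.sum_prod_type]
    _ ≤ ∑ S : Disks δ η, Fintype.card (S.1 → Hint s) * (1 + Real.log (Fintype.card A)) :=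
        sum_le_sum fun S _ => sum_inv_numGuesses_le_of_injective (G S) fun x => hc x S
    _ = δ.choose η * (((2 : ℝ) ^ s) ^ η * (1 + Real.log (Fintype.card A))) := by
        simp only [hcard, sum_const, card_univ, nsmul_eq_mul, Fintype.card_finset_len,
          Fintype.card_fin]

lemma rpow_sum_prod_uniform_rpow [Nonempty R] (hρ : 0 ≤ ρ) {p : A → ℝ} (hp : ∀ x, 0 ≤ p x) :
    (∑ i : A × R, (p i.1 * (Fintype.card R : ℝ)⁻¹) ^ (1 / (1 + ρ))) ^ (1 + ρ) =
      (Fintype.card R : ℝ) ^ ρ * (∑ x, p x ^ (1 / (1 + ρ))) ^ (1 + ρ) := by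
  set N : ℝ := (Fintype.card R : ℝ) with hN
  have hNpos : 0 < N := Nat.cast_pos.2 Fintype.card_pos
  have hρ1 : 1 + ρ ≠ 0 := by positivity
  have hT : 0 ≤ ∑ x, p x ^ (1 / (1 + ρ)) := sum_nonneg fun x _ => Real.rpow_nonneg (hp x) _
  have hsum : ∑ i : A × R, (p i.1 * N⁻¹) ^ (1 / (1 + ρ)) =
      N * N⁻¹ ^ (1 / (1 + ρ)) * ∑ x, p x ^ (1 / (1 + ρ)) := by
    simp only [Fintype.sum_prod_type, sum_const, card_univ, nsmul_eq_mul, ← hN, mul_sum,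
      Real.mul_rpow (hp _) (inv_pos.2 hNpos).le]
    exact sum_congr rfl fun x _ => by ring
  rw [hsum, Real.mul_rpow (by positivity) hT, Real.mul_rpow hNpos.le (by positivity), one_div,
    Real.rpow_inv_rpow (by positivity) hρ1, Real.rpow_one_add' hNpos.le hρ1]
  field_simp

/-- The local randomness of the encoder protects the source if no `η` hints reveal any of it
beyond what they reveal of the source. -/
lemma card_rpow_mul_renyiSum_le_mul_eveAmbiguity [Nonempty R] (hρ : 0 ≤ ρ) {η : ℕ} (hη : η ≤ δ)
    (hP : ∀ x y, 0 ≤ P x y) {c : A → B → R → Fin δ → Hint s}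
    (hc : ∀ x y, ∀ S : Disks δ η, Function.Injective fun r => S.1.restrict (c x y r)) :
    (Fintype.card R : ℝ) ^ ρ * renyiSum ρ P ≤
      (δ.choose η * (((2 : ℝ) ^ s) ^ η * (1 + Real.log (Fintype.card A)))) ^ ρ *
        eveAmbiguity ρ η P (uniformEncoder c) := by
  have := nonempty_disks hη
  obtain ⟨G, hG⟩ : ∃ G : GuessingStrategy A B δ s η, expect P (uniformEncoder c)
      (fun x y m => ⨅ S : Disks δ η, ((G S y (S.1.restrict m)).numGuesses x : ℝ) ^ ρ) =
        eveAmbiguity ρ η P (uniformEncoder c) := exists_eq_ciInf_of_finite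
  let g (x : A) (y : B) (m : Fin δ → Hint s) : ℝ :=
    ⨅ S : Disks δ η, ((G S y (S.1.restrict m)).numGuesses x : ℝ)
  have hg (x : A) (y : B) (m : Fin δ → Hint s) : 0 < g x y m :=
    one_pos.trans_le <| le_ciInf fun S => Nat.one_le_cast.2 (GuessingFn.one_le_numGuesses _ x)
  have hEve : expect P (uniformEncoder c) (fun x y m => g x y m ^ ρ) ≤
      eveAmbiguity ρ η P (uniformEncoder c) := by
    refine hG ▸ expect_mono hP _ fun x y m _ _ => le_ciInf fun S => ?_
    exact Real.rpow_le_rpow (hg x y m).le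
      (Finite.ciInf_le (fun S : Disks δ η => ((G S y (S.1.restrict m)).numGuesses x : ℝ)) S) hρ
  refine le_trans ?_ (mul_le_mul_of_nonneg_left hEve (by positivity))
  rw [expect_uniformEncoder, renyiSum, mul_sum, mul_sum]
  refine sum_le_sum fun y _ => ?_
  have hp (i : A × R) : 0 ≤ P i.1 y * (Fintype.card R : ℝ)⁻¹ := mul_nonneg (hP _ _) (by positivity)
  have hinv (i : A × R) : 0 < g i.1 y (c i.1 y i.2) := hg _ _ _
  rw [← rpow_sum_prod_uniform_rpow hρ fun x => hP x y]
  refine (rpow_sum_rpow_le_mul_sum_mul_rpow univ hρ hp hinv).trans ?_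
  gcongr
  · exact sum_nonneg fun i _ => mul_nonneg (hp i) (Real.rpow_nonneg (hinv i).le ρ)
  · exact sum_nonneg fun i _ => (inv_pos.2 (hinv i)).le
  · exact sum_inv_ciInf_numGuesses_le hη (fun S => G S y) (c := fun x => c x y) fun x => hc x y

end Eve

section Label

variable {A : Type*} [Fintype A] {ρ : ℝ}

/-- The label of `x` is the order of magnitude of `G x`, together with `G x` modulo `K`. -/
lemma GuessingFn.exists_label (G : GuessingFn A) {K : ℕ} (hK : 0 < K) :
    ∃ f : A → Fin (Nat.log 2 (Fintype.card A) + 1) × Fin K, ∀ x,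
      #{x' | f x' = f x} ≤ 2 * G.numGuesses x / K + 1 := by
  have hlog (x : A) : Nat.log 2 (G.numGuesses x) < Nat.log 2 (Fintype.card A) + 1 :=
    Nat.lt_succ_of_le (Nat.log_mono_right (G.numGuesses_le_card x))
  let f (x : A) : Fin (Nat.log 2 (Fintype.card A) + 1) × Fin K :=
    (⟨Nat.log 2 (G.numGuesses x), hlog x⟩, ⟨G.numGuesses x % K, Nat.mod_lt _ hK⟩)
  have hf {x x' : A} (h : f x = f x') : Nat.log 2 (G.numGuesses x) = Nat.log 2 (G.numGuesses x') ∧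
      G.numGuesses x % K = G.numGuesses x' % K := by
    simpa only [f, Prod.mk.injEq, Fin.mk.injEq] using h
  have hmem {x x' : A} (h : x' ∈ (({x' | f x' = f x} : Finset A) : Set A)) : f x' = f x :=
    (mem_filter_univ x').1 (mem_coe.1 h)
  refine ⟨f, fun x => ?_⟩
  rw [← card_range (2 * G.numGuesses x / K + 1)]
  refine card_le_card_of_injOn (fun x' => G.numGuesses x' / K) (fun x' hx' => ?_)
    fun x₁ h₁ x₂ h₂ (hdiv : G.numGuesses x₁ / K = G.numGuesses x₂ / K) => ?_
  · have hlt : G.numGuesses x' < 2 ^ (Nat.log 2 (G.numGuesses x') + 1) :=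
      Nat.lt_pow_succ_log_self one_lt_two _
    have hle : 2 ^ Nat.log 2 (G.numGuesses x) ≤ G.numGuesses x :=
      Nat.pow_log_le_self 2 (Nat.succ_ne_zero _)
    rw [(hf (hmem hx')).1, pow_succ] at hlt
    simp only [coe_range, Set.mem_Iio]
    exact Nat.lt_succ_of_le (Nat.div_le_div_right (by lia))
  · have hmod := (hf ((hmem h₁).trans (hmem h₂).symm)).2
    apply G.numGuesses_injective
    rw [← Nat.div_add_mod (G.numGuesses x₁) K, ← Nat.div_add_mod (G.numGuesses x₂) K, hdiv, hmod]

lemma GuessingFn.exists_label_card_mul_le (G : GuessingFn A) {D : Type*} [Fintype D]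
    [DecidableEq D] (hD : Nat.log 2 (Fintype.card A) + 1 ≤ Fintype.card D) :
    ∃ f : A → D, ∀ x, #{x' | f x' = f x} ≤ 1 ∨
      #{x' | f x' = f x} * Fintype.card D ≤
        8 * (Nat.log 2 (Fintype.card A) + 1) * G.numGuesses x := by
  set J := Nat.log 2 (Fintype.card A) + 1
  set K := Fintype.card D / J with hKdef
  have hJ : 0 < J := Nat.succ_pos _
  have hK : 0 < K := Nat.div_pos hD hJ
  have hDle : Fintype.card D ≤ 2 * (J * K) := by
    have hdiv := Nat.div_add_mod (Fintype.card D) J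
    have hmod := Nat.mod_lt (Fintype.card D) hJ
    have hJK := Nat.le_mul_of_pos_right J hK
    rw [← hKdef] at hdiv
    lia
  obtain ⟨f, hf⟩ := G.exists_label hK
  obtain ⟨e⟩ : Nonempty (Fin J × Fin K ↪ D) := by
    apply Function.Embedding.nonempty_of_card_le
    simpa only [Fintype.card_prod, Fintype.card_fin] using Nat.mul_div_le _ _
  refine ⟨fun x => e (f x), fun x => ?_⟩
  simp only [e.injective.eq_iff]
  rcases lt_or_ge (2 * G.numGuesses x) K with hlt | hge
  · left
    simpa only [Nat.div_eq_of_lt hlt, zero_add] using hf x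
  · right
    have hclass : #{x' | f x' = f x} * K ≤ 4 * G.numGuesses x := by
      have hmul := Nat.mul_le_mul_right K (hf x)
      have hdiv := Nat.div_mul_le_self (2 * G.numGuesses x) K
      rw [add_mul] at hmul
      lia
    calc #{x' | f x' = f x} * Fintype.card D ≤ #{x' | f x' = f x} * (2 * (J * K)) := by gcongr
      _ = 2 * J * (#{x' | f x' = f x} * K) := by ring
      _ ≤ 2 * J * (4 * G.numGuesses x) := by gcongr
      _ = 8 * J * G.numGuesses x := by ring

lemma GuessingFn.exists_label_card_rpow_le (hρ : 0 ≤ ρ) (G : GuessingFn A) {D : Type*}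
    [Fintype D] [DecidableEq D] (hD : Nat.log 2 (Fintype.card A) + 1 ≤ Fintype.card D) :
    ∃ f : A → D, ∀ x, (#{x' | f x' = f x} : ℝ) ^ ρ ≤
      1 + (8 * (Nat.log 2 (Fintype.card A) + 1) / Fintype.card D) ^ ρ *
        (G.numGuesses x : ℝ) ^ ρ := by
  have hDpos : (0 : ℝ) < Fintype.card D := Nat.cast_pos.2 ((Nat.succ_pos _).trans_le hD)
  obtain ⟨f, hf⟩ := G.exists_label_card_mul_le hD
  refine ⟨f, fun x => ?_⟩
  rw [← Real.mul_rpow (by positivity) (by positivity)]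
  rcases hf x with hone | hmul
  · exact (Real.rpow_le_one (by positivity) (Nat.cast_le_one.2 hone) hρ).trans
      (le_add_of_nonneg_right (by positivity))
  · refine (Real.rpow_le_rpow (by positivity) ?_ hρ).trans (le_add_of_nonneg_left zero_le_one)
    rw [div_mul_eq_mul_div, le_div_iff₀ hDpos]
    exact_mod_cast hmul

end Label

section HintCode

variable {D R M : Type*} {δ η ν : ℕ}

/-- A code that stores labels in `D`, with local randomness in `R`, on `δ` disks, such that any
`ν` hints determine the label, and any `η` hints and the label determine the local randomness. -/
structure IsHintCode (ν η : ℕ) (C : D → R → Fin δ → M) : Prop where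
  decode : ∀ S : Disks δ ν, ∀ d r d' r', S.1.restrict (C d r) = S.1.restrict (C d' r') → d = d'
  injective : ∀ d, ∀ S : Disks δ η, Function.Injective fun r => S.1.restrict (C d r)

lemma IsHintCode.relabel {C : D → R → Fin δ → M} (hC : IsHintCode ν η C) (hην : η ≤ ν)
    {D' R' R₁ M' : Type*} {f : D' → D × R₁} (hf : Function.Injective f) {g : R₁ × R' → R}
    (hg : Function.Injective g) {e : M → M'} (he : Function.Injective e) :
    IsHintCode ν η fun d r i => e (C (f d).1 (g ((f d).2, r)) i) where
  decode S d r d' r' h := by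
    have hS : S.1.restrict (C (f d).1 (g ((f d).2, r))) =
        S.1.restrict (C (f d').1 (g ((f d').2, r'))) :=
      funext fun i => he (congrFun h i)
    have hfst : (f d).1 = (f d').1 := hC.decode S _ _ _ _ hS
    obtain ⟨T, hTS, hT⟩ := exists_subset_card_eq (hην.trans_eq S.2.symm)
    have hsnd : g ((f d).2, r) = g ((f d').2, r') := by
      refine hC.injective (f d).1 ⟨T, hT⟩ (funext fun i => ?_)
      simpa only [hfst] using! congrFun hS ⟨i, hTS i.2⟩
    exact hf (Prod.ext hfst (Prod.ext_iff.1 (hg hsnd)).1)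
  injective d S r r' h := by
    have hr : g ((f d).2, r) = g ((f d).2, r') :=
      hC.injective (f d).1 S (funext fun i => he (congrFun h i))
    exact (Prod.ext_iff.1 (hg hr)).2

/-- The Reed–Solomon codeword of the message `w`: the values at the points `p i` of the
polynomial with coefficients `w`. -/
def reedSolomon {ι F : Type*} [Semiring F] (p : ι → F) {n : ℕ} (w : Fin n → F) (i : ι) : F :=
  ∑ j : Fin n, p i ^ (j : ℕ) * w j

lemma eq_of_restrict_reedSolomon_eq {F : Type*} [CommRing F] [IsDomain F] {p : Fin δ → F}
    (hp : Function.Injective p) {n : ℕ} (S : Disks δ n) {w w' : Fin n → F}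
    (h : S.1.restrict (reedSolomon p w) = S.1.restrict (reedSolomon p w')) : w = w' := by
  rw [← sub_eq_zero]
  refine Matrix.eq_zero_of_forall_index_sum_pow_mul_eq_zero
    (f := fun i => p (S.1.orderEmbOfFin S.2 i))
    (hp.comp (S.1.orderEmbOfFin S.2).injective) fun i => ?_
  simp only [Pi.sub_apply, mul_sub, sum_sub_distrib]
  exact sub_eq_zero.2 (congrFun h ⟨_, S.1.orderEmbOfFin_mem S.2 i⟩)

lemma isHintCode_reedSolomon {F : Type*} [CommRing F] [IsDomain F] {p : Fin δ → F}
    (hp : Function.Injective p) (k : ℕ) :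
    IsHintCode (η + k) η fun (d : Fin k → F) (r : Fin η → F) =>
      reedSolomon p (Fin.append r d) where
  decode S d r d' r' h :=
    (Prod.ext_iff.1 ((Fin.appendEquiv η k).injective (a₁ := (r, d)) (a₂ := (r', d'))
      (eq_of_restrict_reedSolomon_eq hp S h))).2
  injective d S r r' h := by
    refine eq_of_restrict_reedSolomon_eq hp S (funext fun i => ?_)
    simpa only [reedSolomon, restrict_def, Fin.val_castAdd, Fin.sum_univ_add, Fin.append_left,
      Fin.append_right, add_left_inj] using congrFun h i

lemma exists_isHintCode {s a : ℕ} (hs : s ≠ 0) (hδ : δ ≤ 2 ^ s) (hην : η ≤ ν) (ha : a ≤ η * s) :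
    ∃ C : Fin (2 ^ (ν * s - a)) → Fin (2 ^ a) → Fin δ → Hint s, IsHintCode ν η C := by
  obtain ⟨k, rfl⟩ := Nat.exists_eq_add_of_le hην
  let F := GaloisField 2 s
  have hcard : Nat.card F = 2 ^ s := GaloisField.card 2 s hs
  have : Finite F := Nat.finite_of_card_ne_zero (by rw [hcard]; positivity)
  have : Fintype F := Fintype.ofFinite F
  replace hcard : Fintype.card F = 2 ^ s := by rw [← Nat.card_eq_fintype_card, hcard]
  obtain ⟨p⟩ : Nonempty (Fin δ ↪ F) :=
    Function.Embedding.nonempty_of_card_le (by rwa [hcard, Fintype.card_fin])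
  have hint : F ≃ Hint s := Fintype.equivOfCardEq (by
    rw [hcard, Fintype.card_fun, Fintype.card_bool, Fintype.card_fin])
  have randomness : Fin (2 ^ (η * s - a)) × Fin (2 ^ a) ≃ (Fin η → F) := Fintype.equivOfCardEq (by
    rw [Fintype.card_prod, Fintype.card_fin, Fintype.card_fin, Fintype.card_fun, Fintype.card_fin,
      hcard, ← pow_add, ← pow_mul, Nat.sub_add_cancel ha, mul_comm])
  have label : Fin (2 ^ ((η + k) * s - a)) ≃ (Fin k → F) × Fin (2 ^ (η * s - a)) :=
    Fintype.equivOfCardEq (by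
      rw [Fintype.card_prod, Fintype.card_fin, Fintype.card_fin, Fintype.card_fun,
        Fintype.card_fin, hcard, ← pow_mul, ← pow_add, add_mul, mul_comm s k]
      congr 1
      lia)
  exact ⟨_, (isHintCode_reedSolomon p.injective k).relabel hην label.injective
    randomness.injective hint.injective⟩

end HintCode

section Direct

variable {A B : Type*} [Fintype A] [Fintype B] {δ s η ν : ℕ} {ρ : ℝ} {P : A → B → ℝ}

lemma IsHintCode.exists_bobListAmbiguity_le (hρ : 0 ≤ ρ) (hν : ν ≤ δ) (hP : IsJointPMF P)
    {D R : Type*} [Fintype D] [Fintype R] [Nonempty R] {C : D → R → Fin δ → Hint s}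
    (hC : IsHintCode ν η C) (hD : Nat.log 2 (Fintype.card A) + 1 ≤ Fintype.card D) :
    ∃ f : B → A → D, bobListAmbiguity ρ ν P (uniformEncoder fun x y => C (f y x)) ≤
      1 + (8 * (Nat.log 2 (Fintype.card A) + 1) / Fintype.card D) ^ ρ * renyiSum ρ P := by
  classical
  have := nonempty_disks hν
  obtain ⟨G, hG⟩ := exists_guessingFn_sum_le_renyiSum hρ hP.nonneg
  choose f hf using fun y => (G y).exists_label_card_rpow_le hρ hD
  refine ⟨f, ?_⟩
  set W : Encoder A B δ s := uniformEncoder fun x y => C (f y x)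
  set Q : ℝ := (8 * (Nat.log 2 (Fintype.card A) + 1) / Fintype.card D) ^ ρ
  have hlist (x : A) (y : B) (m : Fin δ → Hint s) (hm : W x y m ≠ 0) (S : Disks δ ν) :
      decodingList P W S.1 y (S.1.restrict m) ⊆ ({x' | f y x' = f y x} : Finset A) := by
    intro x' hx'
    obtain ⟨m', hm', hm'0⟩ := exists_restrict_eq_of_mem_decodingList hx'
    obtain ⟨r', rfl⟩ := exists_eq_of_uniformEncoder_ne_zero hm'0
    obtain ⟨r, rfl⟩ := exists_eq_of_uniformEncoder_ne_zero hm
    exact (mem_filter_univ _).2 (hC.decode S _ _ _ _ hm')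
  calc bobListAmbiguity ρ ν P W
      ≤ expect P W (fun x y _ => 1 + Q * ((G y).numGuesses x : ℝ) ^ ρ) :=
        expect_mono hP.nonneg _ fun x y m _ hm => ciSup_le fun S =>
          (Real.rpow_le_rpow (Nat.cast_nonneg _)
            (Nat.cast_le.2 (card_le_card (hlist x y m hm S))) hρ).trans (hf y x)
    _ = 1 + Q * ∑ x, ∑ y, P x y * ((G y).numGuesses x : ℝ) ^ ρ := by
        rw [expect_eq_sum]
        simp only [mul_add, mul_one, sum_add_distrib, hP.sum_eq_one, mul_sum, mul_left_comm]
    _ ≤ 1 + Q * renyiSum ρ P := by gcongr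

lemma exists_encoder (hρ : 0 ≤ ρ) (hην : η ≤ ν) (hν : ν ≤ δ) (hP : IsJointPMF P) (hs : s ≠ 0)
    (hδ : δ ≤ 2 ^ s) {a : ℕ} (ha : a ≤ η * s)
    (hlabels : Nat.log 2 (Fintype.card A) + 1 ≤ 2 ^ (ν * s - a)) :
    ∃ W : Encoder A B δ s,
      bobListAmbiguity ρ ν P W ≤
        1 + (8 * (Nat.log 2 (Fintype.card A) + 1) / 2 ^ (ν * s - a)) ^ ρ * renyiSum ρ P ∧
      ((2 : ℝ) ^ a) ^ ρ * renyiSum ρ P ≤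
        (δ.choose η * (((2 : ℝ) ^ s) ^ η * (1 + Real.log (Fintype.card A)))) ^ ρ *
          eveAmbiguity ρ η P W := by
  obtain ⟨C, hC⟩ := exists_isHintCode hs hδ hην ha
  obtain ⟨f, hf⟩ := hC.exists_bobListAmbiguity_le hρ hν hP (by rwa [Fintype.card_fin])
  refine ⟨uniformEncoder fun x y => C (f y x), ?_, ?_⟩
  · simpa only [Fintype.card_fin, Nat.cast_pow, Nat.cast_ofNat] using hf
  · simpa only [Fintype.card_fin, Nat.cast_pow, Nat.cast_ofNat] using
      card_rpow_mul_renyiSum_le_mul_eveAmbiguity hρ (hην.trans hν) hP.nonneg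
        (c := fun x y => C (f y x)) fun x y => hC.injective _

end Direct

section Exponent

variable {u w C : ℕ → ℝ} {c d e : ℝ}

/-- `u n = 2 ^ (n e + o(n))`. Positivity is part of the notion, as `Real.logb` also has values on
`(-∞, 0]`. -/
structure HasExponent (u : ℕ → ℝ) (e : ℝ) : Prop where
  pos : ∀ n, 0 < u n
  tendsto : Tendsto (fun n : ℕ => Real.logb 2 (u n) / n) atTop (𝓝 e)

lemma hasExponent_const (hc : 0 < c) : HasExponent (fun _ => c) 0 :=
  ⟨fun _ => hc, tendsto_const_div_atTop_nhds_zero_nat _⟩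

lemma hasExponent_two_pow {a : ℕ → ℕ} (ha : Tendsto (fun n => (a n : ℝ) / n) atTop (𝓝 e)) :
    HasExponent (fun n => 2 ^ a n) e where
  pos n := by positivity
  tendsto := by
    simpa only [Real.logb_pow, Real.logb_self_eq_one one_lt_two, mul_one] using ha

lemma HasExponent.mul (hu : HasExponent u d) (hw : HasExponent w e) :
    HasExponent (fun n => u n * w n) (d + e) where
  pos n := mul_pos (hu.pos n) (hw.pos n)
  tendsto := by
    simpa only [Real.logb_mul (hu.pos _).ne' (hw.pos _).ne', add_div] using
      hu.tendsto.add hw.tendsto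

lemma HasExponent.div (hu : HasExponent u d) (hw : HasExponent w e) :
    HasExponent (fun n => u n / w n) (d - e) where
  pos n := div_pos (hu.pos n) (hw.pos n)
  tendsto := by
    simpa only [Real.logb_div (hu.pos _).ne' (hw.pos _).ne', sub_div] using
      hu.tendsto.sub hw.tendsto

lemma HasExponent.rpow (hu : HasExponent u e) (r : ℝ) :
    HasExponent (fun n => u n ^ r) (r * e) where
  pos n := Real.rpow_pos_of_pos (hu.pos n) r
  tendsto := by
    simpa only [Real.logb_rpow_eq_mul_logb_of_pos (hu.pos _), mul_div_assoc] using
      hu.tendsto.const_mul r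

lemma HasExponent.pow (hu : HasExponent u e) (k : ℕ) : HasExponent (fun n => u n ^ k) (k * e) := by
  simpa only [Real.rpow_natCast] using hu.rpow k

lemma HasExponent.max (hu : HasExponent u d) (hw : HasExponent w e) :
    HasExponent (fun n => u n ⊔ w n) (d ⊔ e) where
  pos n := lt_max_of_lt_left (hu.pos n)
  tendsto := by
    refine (hu.tendsto.max hw.tendsto).congr fun n => ?_
    rw [max_div_div_right (Nat.cast_nonneg n),
      (Real.strictMonoOn_logb one_lt_two).monotoneOn.map_max (hu.pos n) (hw.pos n)]

lemma hasExponent_zero_of_le_linear (hu : ∀ n, 1 ≤ u n) (h : ∀ n : ℕ, u n ≤ c * (n + 1)) :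
    HasExponent u 0 where
  pos n := one_pos.trans_le (hu n)
  tendsto := by
    have hc : 0 < c := one_pos.trans_le (by simpa using (hu 0).trans (h 0))
    have hlog : Tendsto (fun n : ℕ => (Real.logb 2 (2 * c) + Real.logb 2 n) / n) atTop (𝓝 0) := by
      have hid : Tendsto (fun n : ℕ => Real.log n / n) atTop (𝓝 0) :=
        Real.isLittleO_log_id_atTop.tendsto_div_nhds_zero.comp tendsto_natCast_atTop_atTop
      simpa only [Real.logb, add_div, div_right_comm _ (Real.log 2), zero_div, add_zero] using
        (tendsto_const_div_atTop_nhds_zero_nat (Real.logb 2 (2 * c))).add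
          (hid.div_const (Real.log 2))
    refine squeeze_zero' (.of_forall fun n => ?_) ?_ hlog
    · exact div_nonneg (Real.logb_nonneg one_lt_two (hu n)) (Nat.cast_nonneg n)
    · filter_upwards [eventually_ge_atTop 1] with n hn
      have hn1 : (1 : ℝ) ≤ n := Nat.one_le_cast.2 hn
      gcongr
      rw [← Real.logb_mul (by positivity) (by positivity)]
      exact Real.logb_le_logb_of_le one_lt_two (one_pos.trans_le (hu n))
        ((h n).trans (by nlinarith))

lemma HasExponent.nonneg (h : HasExponent u e) (hu : ∀ n, 1 ≤ u n) : 0 ≤ e :=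
  ge_of_tendsto' h.tendsto fun n =>
    div_nonneg (Real.logb_nonneg one_lt_two (hu n)) (Nat.cast_nonneg n)

lemma HasExponent.eventually_lt (hu : HasExponent u d) (hw : HasExponent w e) (hde : d < e) :
    ∀ᶠ n in atTop, u n < w n := by
  filter_upwards [hu.tendsto.eventually_lt hw.tendsto hde, eventually_gt_atTop 0] with n hn hn0
  rw [div_lt_div_iff_of_pos_right (Nat.cast_pos.2 hn0)] at hn
  exact (Real.logb_lt_logb_iff one_lt_two (hu.pos n) (hw.pos n)).1 hn

lemma HasExponent.tendsto_zero (hu : HasExponent u e) (he : e < 0) : Tendsto u atTop (𝓝 0) := by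
  have hlog : Tendsto (fun n => Real.logb 2 (u n)) atTop atBot := by
    refine (hu.tendsto.neg_mul_atTop he tendsto_natCast_atTop_atTop).congr' ?_
    filter_upwards [eventually_ne_atTop 0] with n hn
    exact div_mul_cancel₀ _ (Nat.cast_ne_zero.2 hn)
  refine ((tendsto_rpow_atBot_of_base_gt_one 2 one_lt_two).comp hlog).congr fun n => ?_
  exact Real.rpow_logb two_pos one_lt_two.ne' (hu.pos n)

/-- The lower exponential growth rate of `u`. -/
noncomputable def lowerExponent (u : ℕ → ℝ) : EReal :=
  liminf (fun n : ℕ => ((Real.logb 2 (u n) / n : ℝ) : EReal)) atTop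

/-- The upper exponential growth rate of `u`. -/
noncomputable def upperExponent (u : ℕ → ℝ) : EReal :=
  limsup (fun n : ℕ => ((Real.logb 2 (u n) / n : ℝ) : EReal)) atTop

lemma lowerExponent_le_upperExponent (u : ℕ → ℝ) : lowerExponent u ≤ upperExponent u :=
  liminf_le_limsup

lemma HasExponent.lowerExponent_eq (hu : HasExponent u e) : lowerExponent u = e :=
  (EReal.tendsto_coe.2 hu.tendsto).liminf_eq

lemma HasExponent.upperExponent_eq (hu : HasExponent u e) : upperExponent u = e :=
  (EReal.tendsto_coe.2 hu.tendsto).limsup_eq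

lemma coe_logb_div_le_coe_logb_div {x y : ℝ} (hx : 0 < x) (hxy : x ≤ y) (n : ℕ) :
    ((Real.logb 2 x / n : ℝ) : EReal) ≤ ((Real.logb 2 y / n : ℝ) : EReal) :=
  EReal.coe_le_coe_iff.2 <| div_le_div_of_nonneg_right
    (Real.logb_le_logb_of_le one_lt_two hx hxy) (Nat.cast_nonneg n)

lemma lowerExponent_mono (hu : ∀ n, 0 < u n) (h : ∀ᶠ n in atTop, u n ≤ w n) :
    lowerExponent u ≤ lowerExponent w :=
  liminf_le_liminf (h.mono fun n hn => coe_logb_div_le_coe_logb_div (hu n) hn n)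

lemma upperExponent_mono (hu : ∀ n, 0 < u n) (h : ∀ᶠ n in atTop, u n ≤ w n) :
    upperExponent u ≤ upperExponent w :=
  limsup_le_limsup (h.mono fun n hn => coe_logb_div_le_coe_logb_div (hu n) hn n)

lemma HasExponent.lowerExponent_mul_le (hC : HasExponent C c) (hw : ∀ n, 0 < w n) :
    lowerExponent (fun n => C n * w n) ≤ c + lowerExponent w := by
  rw [← hC.upperExponent_eq]
  simp only [lowerExponent, upperExponent, Real.logb_mul (hC.pos _).ne' (hw _).ne', add_div,
    EReal.coe_add]
  refine EReal.liminf_add_le (.inl ?_) (.inl ?_)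
  all_goals
    rw [(EReal.tendsto_coe.2 hC.tendsto).limsup_eq]
    simp only [ne_eq, EReal.coe_ne_bot, EReal.coe_ne_top, not_false_eq_true]

end Exponent

section BlockExponents

lemma tendsto_natFloor_mul_div {r : ℝ} (hr : 0 ≤ r) :
    Tendsto (fun n : ℕ => (⌊(n : ℝ) * r⌋₊ : ℝ) / n) atTop (𝓝 r) := by
  simpa only [Function.comp_def, mul_comm] using
    (tendsto_nat_floor_mul_div_atTop hr).comp (tendsto_natCast_atTop_atTop (R := ℝ))

lemma hasExponent_two_pow_hintBits {R : ℝ} (hR : 0 ≤ R) :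
    HasExponent (fun n => 2 ^ hintBits R n) R :=
  hasExponent_two_pow (tendsto_natFloor_mul_div hR)

lemma hasExponent_one_add_log_card (A : Type*) [Fintype A] :
    HasExponent (fun n => 1 + Real.log (Fintype.card (Fin n → A))) 0 := by
  have hlog := Real.log_natCast_nonneg (Fintype.card A)
  refine hasExponent_zero_of_le_linear (c := 1 + Real.log (Fintype.card A))
    (fun n => le_add_of_nonneg_right (Real.log_natCast_nonneg _)) fun n => ?_
  rw [Fintype.card_fun, Fintype.card_fin, Nat.cast_pow, Real.log_pow]
  nlinarith [Nat.cast_nonneg (α := ℝ) n]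

lemma natLog_two_pow_le_mul (c n : ℕ) : Nat.log 2 (c ^ n) ≤ c * n := by
  calc Nat.log 2 (c ^ n) ≤ Nat.log 2 ((2 ^ c) ^ n) :=
        Nat.log_mono_right (Nat.pow_le_pow_left Nat.lt_two_pow_self.le n)
    _ = c * n := by rw [← pow_mul, Nat.log_pow one_lt_two]

lemma hasExponent_natLog_card_add_one (A : Type*) [Fintype A] :
    HasExponent (fun n => (Nat.log 2 (Fintype.card (Fin n → A)) : ℝ) + 1) 0 := by
  refine hasExponent_zero_of_le_linear (c := Fintype.card A + 1)
    (fun n => le_add_of_nonneg_left (Nat.cast_nonneg _)) fun n => ?_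
  rw [Fintype.card_fun, Fintype.card_fin]
  have hle : (Nat.log 2 (Fintype.card A ^ n) : ℝ) ≤ Fintype.card A * n := by
    exact_mod_cast natLog_two_pow_le_mul (Fintype.card A) n
  nlinarith [Nat.cast_nonneg (α := ℝ) n, Nat.cast_nonneg (α := ℝ) (Fintype.card A)]

end BlockExponents

section Asymptotics

variable {A B : Type*} [Fintype A] [Fintype B] {P : (n : ℕ) → (Fin n → A) → (Fin n → B) → ℝ}
  {v : Version} {ρ H R EB E : ℝ} {δ ν η : ℕ}

lemma IsModestAchievable.le_mul_entropy (h : IsModestAchievable v ρ δ ν η R P EB E) (hρ : 0 ≤ ρ)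
    (hη : η ≤ δ) (hP : ∀ n, IsJointPMF (P n))
    (hH : HasExponent (fun n => renyiSum ρ (P n)) (ρ * H)) : E ≤ ρ * H := by
  obtain ⟨W, -, hE⟩ := h
  rw [← EReal.coe_le_coe_iff, ← hH.lowerExponent_eq]
  exact hE.trans <| lowerExponent_mono
    (fun n => one_pos.trans_le (one_le_eveAmbiguity hρ hη (hP n) (W n)))
    (.of_forall fun n => eveAmbiguity_le_renyiSum hρ hη (hP n).nonneg (W n))

lemma le_add_of_le_mul_bobAmbiguity {W : EncoderSeq A B δ R} {u C : ℕ → ℝ} {c e : ℝ}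
    (hρ : 0 ≤ ρ) (hν : ν ≤ δ) (hP : ∀ n, IsJointPMF (P n))
    (hB : upperExponent (fun n => bobAmbiguity v ρ ν (P n) (W n)) ≤ EB)
    (hu : ∀ n, 0 < u n) (he : e ≤ lowerExponent u) (hC : HasExponent C c)
    (h : ∀ n, u n ≤ C n * bobGuessAmbiguity ρ ν (P n) (W n)) : e ≤ c + EB := by
  have hle (n : ℕ) : u n ≤ C n * bobAmbiguity v ρ ν (P n) (W n) :=
    (h n).trans <| mul_le_mul_of_nonneg_left
      (bobGuessAmbiguity_le_bobAmbiguity hρ ν (hP n).nonneg v (W n)) (hC.pos n).le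
  have hpos (n : ℕ) : 0 < bobAmbiguity v ρ ν (P n) (W n) :=
    one_pos.trans_le (one_le_bobAmbiguity hρ hν (hP n) v (W n))
  rw [← EReal.coe_le_coe_iff, EReal.coe_add]
  calc (e : EReal) ≤ lowerExponent u := he
    _ ≤ lowerExponent (fun n => C n * bobAmbiguity v ρ ν (P n) (W n)) :=
        lowerExponent_mono hu (.of_forall hle)
    _ ≤ c + lowerExponent (fun n => bobAmbiguity v ρ ν (P n) (W n)) :=
        hC.lowerExponent_mul_le hpos
    _ ≤ c + EB := by gcongr; exact (lowerExponent_le_upperExponent _).trans hB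

lemma IsModestAchievable.le_mul_rate_add (h : IsModestAchievable v ρ δ ν η R P EB E) (hρ : 0 ≤ ρ)
    (hη : η ≤ ν) (hν : ν ≤ δ) (hP : ∀ n, IsJointPMF (P n)) (hR : 0 ≤ R) :
    E ≤ ρ * R * ((ν : ℝ) - η) + EB := by
  obtain ⟨W, hB, hE⟩ := h
  have hC := ((hasExponent_two_pow_hintBits hR).pow (ν - η)).rpow ρ
  refine (le_add_of_le_mul_bobAmbiguity hρ hν hP hB
    (fun n => one_pos.trans_le (one_le_eveAmbiguity hρ (hη.trans hν) (hP n) (W n))) hE hC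
    fun n => eveAmbiguity_le_mul_bobGuessAmbiguity hρ hη hν (hP n).nonneg (W n)).trans_eq ?_
  rw [Nat.cast_sub hη]
  ring

lemma IsModestAchievable.mul_entropy_le (h : IsModestAchievable v ρ δ ν η R P EB E) (hρ : 0 ≤ ρ)
    (hν : ν ≤ δ) (hP : ∀ n, IsJointPMF (P n))
    (hH : HasExponent (fun n => renyiSum ρ (P n)) (ρ * H)) (hR : 0 ≤ R) :
    ρ * H ≤ ρ * (ν * R) + EB := by
  obtain ⟨W, hB, -⟩ := h
  have hC := ((hasExponent_one_add_log_card A).mul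
    ((hasExponent_two_pow_hintBits hR).pow ν)).rpow ρ
  refine (le_add_of_le_mul_bobAmbiguity hρ hν hP hB hH.pos hH.lowerExponent_eq.ge hC
    fun n => renyiSum_le_mul_bobGuessAmbiguity hρ hν (hP n).nonneg (W n)).trans_eq ?_
  ring

lemma IsAchievable.isModestAchievable (h : IsAchievable v ρ δ ν η R P E) :
    IsModestAchievable v ρ δ ν η R P 0 E := by
  obtain ⟨W, hB, hE⟩ := h
  refine ⟨W, ?_, hE⟩
  have hlog : Tendsto (fun n => Real.logb 2 (bobAmbiguity v ρ ν (P n) (W n))) atTop (𝓝 0) := by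
    simpa only [Real.logb, Real.log_one, zero_div] using
      (hB.log one_ne_zero).div_const (Real.log 2)
  exact (EReal.tendsto_coe.2 (hlog.div_atTop tendsto_natCast_atTop_atTop)).limsup_eq.le

lemma exists_tendsto_div_of_le {r α : ℝ} (hr : 0 ≤ r) (hα : 0 ≤ α) (k : ℕ) (hαr : α ≤ k * r) :
    ∃ a : ℕ → ℕ, (∀ n, a n ≤ k * hintBits r n) ∧
      Tendsto (fun n => (a n : ℝ) / n) atTop (𝓝 α) := by
  refine ⟨fun n => min ⌊(n : ℝ) * α⌋₊ (k * hintBits r n), fun n => min_le_right _ _, ?_⟩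
  have hmin := (tendsto_natFloor_mul_div hα).min ((tendsto_natFloor_mul_div hr).const_mul (k : ℝ))
  rw [min_eq_left hαr] at hmin
  refine hmin.congr fun n => ?_
  rw [Nat.cast_min, Nat.cast_mul, ← mul_div_assoc, min_div_div_right (Nat.cast_nonneg n)]

lemma eventually_le_two_pow_hintBits (δ : ℕ) (hR : 0 < R) :
    ∀ᶠ n in atTop, hintBits R n ≠ 0 ∧ δ ≤ 2 ^ hintBits R n := by
  have htop : Tendsto (fun n => hintBits R n) atTop atTop :=
    tendsto_nat_floor_atTop.comp (tendsto_natCast_atTop_atTop.atTop_mul_const hR)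
  filter_upwards [htop.eventually_ge_atTop (δ + 1)] with n hn
  exact ⟨by lia, (Nat.le_of_succ_le hn).trans Nat.lt_two_pow_self.le⟩

/-- `α` is the rate of the local randomness of the encoders. -/
lemma exists_encoderSeq (hρ : 0 ≤ ρ) (hην : η < ν) (hν : ν ≤ δ) (hP : ∀ n, IsJointPMF (P n))
    (hH : HasExponent (fun n => renyiSum ρ (P n)) (ρ * H)) (hR : 0 < R) {α : ℝ} (hα : 0 ≤ α)
    (hαR : α ≤ η * R) :
    ∃ (W : EncoderSeq A B δ R) (T : ℕ → ℝ), HasExponent T (ρ * (H - (ν * R - α))) ∧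
      (∀ᶠ n in atTop, bobListAmbiguity ρ ν (P n) (W n) ≤ 1 + T n) ∧
      ((ρ * (α + H - η * R) : ℝ) : EReal) ≤
        lowerExponent fun n => eveAmbiguity ρ η (P n) (W n) := by
  obtain ⟨a, ha, haα⟩ := exists_tendsto_div_of_le hR.le hα η hαR
  have hlabels : HasExponent (fun n => 2 ^ (ν * hintBits R n - a n)) (ν * R - α) := by
    refine hasExponent_two_pow
      ((((tendsto_natFloor_mul_div hR.le).const_mul (ν : ℝ)).sub haα).congr fun n => ?_)
    rw [Nat.cast_sub ((ha n).trans (Nat.mul_le_mul_right _ hην.le)), sub_div, Nat.cast_mul,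
      mul_div_assoc]
  have hνR : 0 < ν * R - α :=
    sub_pos.2 (hαR.trans_lt (mul_lt_mul_of_pos_right (Nat.cast_lt.2 hην) hR))
  have hlog := hasExponent_natLog_card_add_one A
  obtain ⟨W, hW⟩ := Filter.skolem.1 <|
    ((eventually_le_two_pow_hintBits δ hR).and (hlog.eventually_lt hlabels hνR)).mono
      fun n hn => exists_encoder hρ hην.le hν (hP n) hn.1.1 hn.1.2 (ha n)
        (by exact_mod_cast hn.2.le)
  have hT := ((((hasExponent_const (by norm_num : (0 : ℝ) < 8)).mul hlog).div hlabels).rpow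
    ρ).mul hH
  have hC := (((hasExponent_const (Nat.cast_pos.2 (Nat.choose_pos (hην.le.trans hν)))).mul
    (((hasExponent_two_pow_hintBits hR.le).pow η).mul (hasExponent_one_add_log_card A))).rpow ρ)
  have hD := (((hasExponent_two_pow haα).rpow ρ).mul hH).div hC
  refine ⟨W, _, ?_, hW.mono fun n hn => hn.1, ?_⟩
  · convert hT using 1
    ring
  · refine Eq.trans_le ?_ (hD.lowerExponent_eq.ge.trans
      (lowerExponent_mono hD.pos (hW.mono fun n hn => ?_)))
    · congr 1
      ring
    · rw [div_le_iff₀' (hC.pos n)]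
      exact hn.2

lemma isModestAchievable_of_pos (hρ : 0 < ρ) (hην : η < ν) (hν : ν ≤ δ)
    (hP : ∀ n, IsJointPMF (P n)) (hH : HasExponent (fun n => renyiSum ρ (P n)) (ρ * H))
    (hR : 0 < R) (v : Version) (hEB : 0 ≤ EB) (h : H - ρ⁻¹ * EB ≤ ν * R) :
    IsModestAchievable v ρ δ ν η R P EB (min (ρ * R * ((ν : ℝ) - η) + EB) (ρ * H)) := by
  set α := min (η * R) (ν * R - (H - ρ⁻¹ * EB)) with hα
  obtain ⟨W, T, hT, hB, hE⟩ := exists_encoderSeq hρ.le hην hν hP hH hR (α := α)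
    (le_min (by positivity) (sub_nonneg.2 h)) (min_le_left _ _)
  refine ⟨W, ?_, hE.trans_eq' ?_⟩
  · have hmax := (hasExponent_const two_pos).mul ((hasExponent_const one_pos).max hT)
    have hle : 0 + max 0 (ρ * (H - (ν * R - α))) ≤ EB := by
      rw [zero_add, max_le_iff, ← le_inv_mul_iff₀ hρ]
      exact ⟨hEB, by linarith [min_le_right (η * R) (ν * R - (H - ρ⁻¹ * EB))]⟩
    refine (upperExponent_mono
      (fun n => one_pos.trans_le (one_le_bobAmbiguity hρ.le hν (hP n) v (W n))) ?_).trans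
      (hmax.upperExponent_eq.trans_le (EReal.coe_le_coe_iff.2 hle))
    filter_upwards [hB] with n hn
    refine (bobAmbiguity_le_bobListAmbiguity hρ.le ν (hP n).nonneg v (W n)).trans (hn.trans ?_)
    linarith [le_max_left 1 (T n), le_max_right 1 (T n)]
  · have hmin : α + H - η * R = min (R * ((ν : ℝ) - η) + ρ⁻¹ * EB) H := by
      rw [hα, add_sub_assoc, ← min_add_add_right, min_comm]
      congr 1 <;> ring
    rw [hmin, mul_min_of_nonneg _ _ hρ.le, mul_add, mul_inv_cancel_left₀ hρ.ne', mul_assoc]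

lemma isModestAchievable_guessing_zero (hρ : 0 ≤ ρ) (hη : η ≤ δ) (hν : ν ≤ δ)
    (hP : ∀ n, IsJointPMF (P n)) (hH : HasExponent (fun n => renyiSum ρ (P n)) (ρ * H))
    (h : ρ * H ≤ EB) : IsModestAchievable .guessing ρ δ ν η 0 P EB (ρ * H) := by
  let c (n : ℕ) (_ : Fin n → A) (_ : Fin n → B) (_ : Unit) : Fin δ → Hint (hintBits 0 n) :=
    fun _ _ => false
  have hC := (((hasExponent_const (Nat.cast_pos.2 (Nat.choose_pos hη))).mul
    (((hasExponent_two_pow_hintBits le_rfl).pow η).mul (hasExponent_one_add_log_card A))).rpow ρ)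
  have hD := hH.div hC
  refine ⟨fun n => uniformEncoder (c n), ?_, ?_⟩
  · refine (upperExponent_mono
      (fun n => one_pos.trans_le (one_le_bobGuessAmbiguity hρ hν (hP n) _))
      (.of_forall fun n => bobGuessAmbiguity_le_renyiSum hρ hν (hP n).nonneg _)).trans ?_
    exact hH.upperExponent_eq.trans_le (EReal.coe_le_coe_iff.2 h)
  · refine Eq.trans_le ?_ (hD.lowerExponent_eq.ge.trans
      (lowerExponent_mono hD.pos (.of_forall fun n => ?_)))
    · simp
    · rw [div_le_iff₀' (hC.pos n)]
      simpa only [Fintype.card_unit, Nat.cast_one, Real.one_rpow, one_mul] using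
        card_rpow_mul_renyiSum_le_mul_eveAmbiguity hρ hη (hP n).nonneg (c := c n)
          fun x y S => Function.injective_of_subsingleton _

lemma isAchievable_of_lt (hρ : 0 < ρ) (hην : η < ν) (hν : ν ≤ δ) (hP : ∀ n, IsJointPMF (P n))
    (hH : HasExponent (fun n => renyiSum ρ (P n)) (ρ * H)) (hR : 0 < R) (v : Version)
    (h : H < ν * R) (hE : E < ρ * min (R * ((ν : ℝ) - η)) H) : IsAchievable v ρ δ ν η R P E := by
  have hE' : ρ⁻¹ * E < min (R * ((ν : ℝ) - η)) H := by rwa [inv_mul_lt_iff₀ hρ]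
  obtain ⟨hEν, hEH⟩ := lt_min_iff.1 hE'
  set α := max 0 (ρ⁻¹ * E - H + η * R)
  obtain ⟨W, T, hT, hB, hEve⟩ := exists_encoderSeq hρ.le hην hν hP hH hR (α := α)
    (le_max_left _ _) (max_le (by positivity) (by linarith))
  refine ⟨W, ?_, hEve.trans' (EReal.coe_le_coe_iff.2 ?_)⟩
  · have hα : α < ν * R - H := max_lt (sub_pos.2 h) (by linarith)
    have hlim : Tendsto (fun n => 1 + T n) atTop (𝓝 1) := by
      simpa only [add_zero] using
        (hT.tendsto_zero (mul_neg_of_pos_of_neg hρ (by linarith))).const_add 1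
    refine tendsto_of_tendsto_of_tendsto_of_le_of_le' tendsto_const_nhds hlim
      (.of_forall fun n => one_le_bobAmbiguity hρ.le hν (hP n) v (W n)) ?_
    filter_upwards [hB] with n hn
    exact (bobAmbiguity_le_bobListAmbiguity hρ.le ν (hP n).nonneg v (W n)).trans hn
  · rw [← inv_mul_le_iff₀ hρ]
    linarith [le_max_right 0 (ρ⁻¹ * E - H + η * R)]

lemma hasExponent_renyiSum (hρ : 0 < ρ) (hP : ∀ n, IsJointPMF (P n))
    (hH : Tendsto (fun n : ℕ => condRenyiEntropy (1 / (1 + ρ)) (P n) / n) atTop (𝓝 H)) :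
    HasExponent (fun n => renyiSum ρ (P n)) (ρ * H) where
  pos n := one_pos.trans_le ((hP n).one_le_renyiSum hρ.le)
  tendsto := by simpa only [logb_renyiSum hρ, mul_div_assoc] using hH.const_mul ρ

lemma privacyExponent_eq (hρ : 0 < ρ) (hην : η < ν) (hν : ν ≤ δ) (hP : ∀ n, IsJointPMF (P n))
    (hH : HasExponent (fun n => renyiSum ρ (P n)) (ρ * H)) (hR : 0 ≤ R) (v : Version)
    (h : H < ν * R) :
    privacyExponent v ρ δ ν η R P = ((ρ * min (R * ((ν : ℝ) - η)) H : ℝ) : EReal) := by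
  have hH0 : 0 ≤ H := nonneg_of_mul_nonneg_right
    (hH.nonneg fun n => (hP n).one_le_renyiSum hρ.le) hρ
  have hR' : 0 < R := hR.lt_of_ne' <| right_ne_zero_of_mul (hH0.trans_lt h).ne'
  refine le_antisymm (iSup_le fun ⟨E, hE⟩ => EReal.coe_le_coe_iff.2 ?_)
    (EReal.ge_of_forall_gt_iff_ge.1 fun E hE => ?_)
  · have hrate := hE.isModestAchievable.le_mul_rate_add hρ.le hην.le hν hP hR
    rw [mul_min_of_nonneg _ _ hρ.le]
    exact le_min (by linarith)
      (hE.isModestAchievable.le_mul_entropy hρ.le (hην.le.trans hν) hP hH)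
  · exact le_iSup (fun E : {E : ℝ // IsAchievable v ρ δ ν η R P E} => ((E : ℝ) : EReal))
      ⟨E, isAchievable_of_lt hρ hην hν hP hH hR' v h (EReal.coe_lt_coe_iff.1 hE)⟩

lemma privacyExponent_eq_bot (hρ : 0 < ρ) (hν : ν ≤ δ) (hP : ∀ n, IsJointPMF (P n))
    (hH : HasExponent (fun n => renyiSum ρ (P n)) (ρ * H)) (hR : 0 ≤ R) (v : Version)
    (h : ν * R < H) : privacyExponent v ρ δ ν η R P = ⊥ := by
  refine iSup_eq_bot.2 fun ⟨E, hE⟩ => absurd h (not_lt_of_ge (le_of_mul_le_mul_left ?_ hρ))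
  simpa only [add_zero] using hE.isModestAchievable.mul_entropy_le hρ.le hν hP hH hR

lemma modestPrivacyExponent_eq (hρ : 0 < ρ) (hην : η < ν) (hν : ν ≤ δ)
    (hP : ∀ n, IsJointPMF (P n)) (hH : HasExponent (fun n => renyiSum ρ (P n)) (ρ * H))
    (hR : 0 ≤ R) (hEB : 0 ≤ EB) (h : H - ρ⁻¹ * EB ≤ ν * R) (hv : v = .list → 0 < R) :
    modestPrivacyExponent v ρ δ ν η R P EB =
      ((min (ρ * R * ((ν : ℝ) - η) + EB) (ρ * H) : ℝ) : EReal) := by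
  have hach : IsModestAchievable v ρ δ ν η R P EB
      (min (ρ * R * ((ν : ℝ) - η) + EB) (ρ * H)) := by
    rcases hR.eq_or_lt with rfl | hR'
    · have hle : ρ * H ≤ EB := by
        rw [← le_inv_mul_iff₀ hρ]
        linarith
      cases v with
      | guessing =>
        rw [mul_zero, zero_mul, zero_add, min_eq_right hle]
        exact isModestAchievable_guessing_zero hρ.le (hην.le.trans hν) hν hP hH hle
      | list => exact absurd (hv rfl) (lt_irrefl 0)
    · exact isModestAchievable_of_pos hρ hην hν hP hH hR' v hEB h
  refine le_antisymm (iSup_le fun ⟨E, hE⟩ => EReal.coe_le_coe_iff.2 ?_) ?_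
  · exact le_min (hE.le_mul_rate_add hρ.le hην.le hν hP hR)
      (hE.le_mul_entropy hρ.le (hην.le.trans hν) hP hH)
  · exact le_iSup (fun E : {E : ℝ // IsModestAchievable v ρ δ ν η R P EB E} =>
      ((E : ℝ) : EReal)) ⟨_, hach⟩

lemma modestPrivacyExponent_eq_bot (hρ : 0 < ρ) (hν : ν ≤ δ) (hP : ∀ n, IsJointPMF (P n))
    (hH : HasExponent (fun n => renyiSum ρ (P n)) (ρ * H)) (hR : 0 ≤ R) (v : Version)
    (h : ν * R < H - ρ⁻¹ * EB) : modestPrivacyExponent v ρ δ ν η R P EB = ⊥ := by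
  refine iSup_eq_bot.2 fun ⟨E, hE⟩ => ?_
  have hle := hE.mul_entropy_le hρ.le hν hP hH hR
  rw [← mul_lt_mul_iff_right₀ hρ, mul_sub, mul_inv_cancel_left₀ hρ.ne'] at h
  linarith

end Asymptotics

section BlockPMF

open MeasureTheory

lemma isJointPMF_blockPMF {Ω A B : Type*} [MeasurableSpace Ω] (μ : Measure Ω)
    [IsProbabilityMeasure μ] [Fintype A] [MeasurableSpace A] [DiscreteMeasurableSpace A]
    [Fintype B] [MeasurableSpace B] [DiscreteMeasurableSpace B] {X : ℕ → Ω → A} {Y : ℕ → Ω → B}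
    (hX : ∀ i, Measurable (X i)) (hY : ∀ i, Measurable (Y i)) (n : ℕ) :
    IsJointPMF (blockPMF μ X Y n) where
  nonneg _ _ := measureReal_nonneg
  sum_eq_one := by
    let f (ω : Ω) : (Fin n → A) × (Fin n → B) := (fun i => X i ω, fun i => Y i ω)
    have hf : Measurable f :=
      (measurable_pi_lambda _ fun i : Fin n => hX i).prodMk
        (measurable_pi_lambda _ fun i : Fin n => hY i)
    have hblock (p : (Fin n → A) × (Fin n → B)) :
        blockPMF μ X Y n p.1 p.2 = μ.real (f ⁻¹' {p}) := by
      rw [blockPMF]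
      congr 1
      ext ω
      simp only [Set.mem_ofPred_eq, Set.mem_preimage, Set.mem_singleton_iff, Prod.ext_iff,
        funext_iff, f]
    rw [← Fintype.sum_prod_type', Fintype.sum_congr _ _ hblock,
      sum_measureReal_preimage_singleton univ fun p _ => hf (measurableSet_singleton p),
      coe_univ, Set.preimage_univ, probReal_univ]

end BlockPMF

end DiskFailure

theorem mainTheorem9_general {A B : Type*} [Fintype A] [Fintype B]
    (P : (n : ℕ) → (Fin n → A) → (Fin n → B) → ℝ) (hP : ∀ n, DiskFailure.IsJointPMF (P n))
    (ρ : ℝ) (hρ : 0 < ρ) (δ ν η : ℕ) (hνδ : ν ≤ δ) (hην : η < ν) (H : ℝ)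
    (hH : Filter.Tendsto
      (fun n : ℕ => DiskFailure.condRenyiEntropy (1 / (1 + ρ)) (P n) / n)
      Filter.atTop (nhds H))
    (Rs : ℝ) (hRs : 0 ≤ Rs) (v : DiskFailure.Version) :
    (H < ν * Rs →
      DiskFailure.privacyExponent v ρ δ ν η Rs P
        = ((ρ * min (Rs * ((ν : ℝ) - η)) H : ℝ) : EReal)) ∧
    (ν * Rs < H →
      DiskFailure.privacyExponent v ρ δ ν η Rs P = ⊥) ∧
    (∀ EB : ℝ, 0 ≤ EB →
      (H - ρ⁻¹ * EB ≤ ν * Rs → (v = DiskFailure.Version.list → 0 < Rs) →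
        DiskFailure.modestPrivacyExponent v ρ δ ν η Rs P EB
          = ((min (ρ * Rs * ((ν : ℝ) - η) + EB) (ρ * H) : ℝ) : EReal)) ∧
      (ν * Rs < H - ρ⁻¹ * EB →
        DiskFailure.modestPrivacyExponent v ρ δ ν η Rs P EB = ⊥)) := by
  have hexp := DiskFailure.hasExponent_renyiSum hρ hP hH
  exact ⟨DiskFailure.privacyExponent_eq hρ hην hνδ hP hexp hRs v,
    DiskFailure.privacyExponent_eq_bot hρ hνδ hP hexp hRs v, fun EB hEB =>
      ⟨DiskFailure.modestPrivacyExponent_eq hρ hην hνδ hP hexp hRs hEB,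
        DiskFailure.modestPrivacyExponent_eq_bot hρ hνδ hP hexp hRs v⟩⟩

theorem mainTheorem9
    {Ω A B : Type*} [MeasurableSpace Ω] (μ : MeasureTheory.Measure Ω)
    [MeasureTheory.IsProbabilityMeasure μ]
    [Fintype A] [MeasurableSpace A] [DiscreteMeasurableSpace A]
    [Fintype B] [MeasurableSpace B] [DiscreteMeasurableSpace B]
    (X : ℕ → Ω → A) (Y : ℕ → Ω → B)
    (hX : ∀ i, Measurable (X i)) (hY : ∀ i, Measurable (Y i))
    (ρ : ℝ) (hρ : 0 < ρ)
    (δ ν η : ℕ) (hνδ : ν ≤ δ) (hην : η < ν)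
    (H : ℝ)
    (hH : Filter.Tendsto
      (fun n : ℕ =>
        DiskFailure.condRenyiEntropy (1 / (1 + ρ)) (DiskFailure.blockPMF μ X Y n) / n)
      Filter.atTop (nhds H))
    (Rs : ℝ) (hRs : 0 ≤ Rs) (v : DiskFailure.Version) :
    (H < ν * Rs →
      DiskFailure.privacyExponent v ρ δ ν η Rs (DiskFailure.blockPMF μ X Y)
        = ((ρ * min (Rs * ((ν : ℝ) - η)) H : ℝ) : EReal)) ∧
    (ν * Rs < H →
      DiskFailure.privacyExponent v ρ δ ν η Rs (DiskFailure.blockPMF μ X Y) = ⊥) ∧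
    (∀ EB : ℝ, 0 ≤ EB →
      (H - ρ⁻¹ * EB ≤ ν * Rs → (v = DiskFailure.Version.list → 0 < Rs) →
        DiskFailure.modestPrivacyExponent v ρ δ ν η Rs (DiskFailure.blockPMF μ X Y) EB
          = ((min (ρ * Rs * ((ν : ℝ) - η) + EB) (ρ * H) : ℝ) : EReal)) ∧
      (ν * Rs < H - ρ⁻¹ * EB →
        DiskFailure.modestPrivacyExponent v ρ δ ν η Rs (DiskFailure.blockPMF μ X Y) EB = ⊥)) :=
  mainTheorem9_general _ (DiskFailure.isJointPMF_blockPMF μ hX hY) ρ hρ δ ν η hνδ hην H hH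
    Rs hRs v
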